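/- **Setting.** Let $T>0$, and let $\alpha:[0,T]\to(0,\infty)$ and $\sigma:[0,T]\to[0,\infty)$ be a noise schedule, $\sigma$ continuous with $\sigma_s>0$ for $s>0$, such that the signal-to-noise ratio $\alpha_s^2/\sigma_s^2=e^{\lambda_s}$ is strictly decreasing (with $\lambda_0=\infty$ if $\sigma_0=0$). Assume that $f(s)=\frac{d}{ds}\log\alpha_s$ exists and is continuous on $[0,T]$ and that $g$ is a continuous function on $[0,T]$ with $g^2(s)=-\frac{d\lambda_s}{ds}\sigma_s^2$ for $s\in(0,T]$. Consider the linear-drift diffusion $dx_s=f(s)x_s\,ds+g(s)\,dW_s$ on $\mathbb R^D$, started from a probability density $p_0\in C^3(\mathbb R^D)$. For $0\le s<t\le T$ its transition density is Gaussian, $$p_{t|s}(x\mid z)=\mathcal N\!\left(x;\ \tfrac{\alpha_t}{\alpha_s}z,\ \left(\sigma_t^2-\tfrac{\alpha_t^2}{\alpha_s^2}\sigma_s^2\right)I_D\right)$$ (so $p_{t|0}(x\mid z)=\mathcal N(x;\alpha_t z,\sigma_t^2I_D)$ when $\alpha_0=1$, $\sigma_0=0$); its marginal density is $p_s(x)=\int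 p_{s|0}(x\mid z)p_0(z)\,dz$ for $s>0$, and the denoising density is $p(x_s\mid x_t)=p_{t|s}(x_t\mid x_s)\,p_s(x_s)/p_t(x_t)$ for $0\le s<t$. **Theorem (Mode-tracking ODE).** Let $t\in(0,T]$ and $x_t\in\mathbb R^D$. Suppose $s\mapsto y_s$ is a curve in $\mathbb R^D$, continuous on $[0,t]$ and continuously differentiable on $[0,t)$, such that $$p(y_s\mid x_t)=\max_{x_s}p(x_s\mid x_t)\qquad\text{for all } 0<s<t.$$ Put $A(s,y)=\nabla_y^2\log p_s(y)-\psi(s)I_D$, where $$\psi(s)=\frac1{\sigma_s^2}\,\frac{e^{\lambda_t}}{e^{\lambda_s}-e^{\lambda_t}}$$ (for $s=0$ and $\sigma_0=0$ this is read as its limit $\alpha_t^2/(\alpha_0^2\sigma_t^2)$), and $\Delta_y=\sum_i\partial^2/\partial y_i^2$. Then: 1. $y_t=x_t$. 2. For every $s\in[0,t)$, $$A(s,y_s)\left(\dot y_s-f(s)y_s+g^2(s)\nabla_y\log p_s(y_s)\right)=-\tfrac12 g^2(s)\nabla_y\Delta_y\log p_s(y_s).$$ 3. For every $s\in[0,t)$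 at which $A(s,y_s)$ is invertible, $$\dot y_s=f(s)y_s-g^2(s)\nabla_y\log p_s(y_s)-\tfrac12 g^2(s)A(s,y_s)^{-1}\nabla_y\Delta_y\log p_s(y_s).$$ 4. In particular, $p(y_0\mid x_t)=\max_{x_0}p(x_0\mid x_t)$. At $s=0$ derivatives in $s$ are one-sided. -/

import Mathlib

open Real Set Filter Topology MeasureTheory

noncomputable section

namespace ModeTracking

/-- A noise schedule on `[0, T]`: signal level `α`, noise level `σ`, with a decreasing
signal-to-noise ratio, and the coefficients `f`, `g` of the linear-drift SDE
`dx = f(s) x ds + g(s) dW`, where `f = (log α)'` and `g² = -λ' σ²`, `λ = log (α² / σ²)`.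
Both `σ 0 = 0` (then `λ 0 = ∞`) and `σ 0 > 0` (finite maximal log-SNR) are allowed;
if `σ 0 = 0`, the value `g 0` is the continuous extension. -/
structure NoiseSchedule (T : ℝ) where
  α : ℝ → ℝ
  σ : ℝ → ℝ
  f : ℝ → ℝ
  g : ℝ → ℝ
  α_pos : ∀ s ∈ Icc 0 T, 0 < α s
  σ_nonneg : 0 ≤ σ 0
  σ_pos : ∀ s ∈ Ioc 0 T, 0 < σ s
  σ_cont : ContinuousOn σ (Icc 0 T)
  /-- The noise-to-signal ratio increases, i.e. the signal-to-noise ratio `α² / σ²` decreases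
  (written so that it also makes sense at `σ 0 = 0`). -/
  snr_decreasing : StrictMonoOn (fun s => σ s ^ 2 / α s ^ 2) (Icc 0 T)
  f_eq : ∀ s ∈ Icc 0 T, HasDerivWithinAt (fun u => Real.log (α u)) (f s) (Icc 0 T) s
  g_eq : ∀ s ∈ Ioc 0 T, ∃ l' : ℝ,
    HasDerivWithinAt (fun u => Real.log (α u ^ 2 / σ u ^ 2)) l' (Icc 0 T) s ∧
      g s ^ 2 = -l' * σ s ^ 2
  f_cont : ContinuousOn f (Icc 0 T)
  g_cont : ContinuousOn g (Icc 0 T)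

/-- Density at `x` of the isotropic Gaussian `N(m, v I)` on `ℝ^D`, for `v > 0`. -/
def gaussianDensity {D : ℕ} (m : EuclideanSpace ℝ (Fin D)) (v : ℝ)
    (x : EuclideanSpace ℝ (Fin D)) : ℝ :=
  (√(2 * π * v) ^ D)⁻¹ * Real.exp (-‖x - m‖ ^ 2 / (2 * v))

namespace NoiseSchedule

variable {T : ℝ} (S : NoiseSchedule T)

/-- Log signal-to-noise ratio `λ_s` (meaningful when `σ s > 0`). -/
def logSNR (s : ℝ) : ℝ := Real.log (S.α s ^ 2 / S.σ s ^ 2)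

/-- `α_t / α_s`. -/
def transMean (s t : ℝ) : ℝ := S.α t / S.α s

/-- `σ_t² - (α_t / α_s)² σ_s²`. -/
def transVar (s t : ℝ) : ℝ := S.σ t ^ 2 - S.transMean s t ^ 2 * S.σ s ^ 2

/-- Forward transition density `p_{t|s}(x | z)`, for `s < t`, of the linear-drift SDE. -/
def transDensity {D : ℕ} (s t : ℝ) (x z : EuclideanSpace ℝ (Fin D)) : ℝ :=
  gaussianDensity (S.transMean s t • z) (S.transVar s t) x

/-- Marginal density `p_s` of the SDE started from the density `p₀`. -/
def marginal {D : ℕ} (p₀ : EuclideanSpace ℝ (Fin D) → ℝ) (s : ℝ)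
    (x : EuclideanSpace ℝ (Fin D)) : ℝ :=
  if s = 0 then p₀ x else ∫ z, S.transDensity 0 s x z * p₀ z

/-- Denoising density `p_{s|t}(x | x_t) = p_{t|s}(x_t | x) p_s(x) / p_t(x_t)`, for `s < t`. -/
def denoising {D : ℕ} (p₀ : EuclideanSpace ℝ (Fin D) → ℝ) (s t : ℝ)
    (x xt : EuclideanSpace ℝ (Fin D)) : ℝ :=
  S.transDensity s t xt x * S.marginal p₀ s x / S.marginal p₀ t xt

/-- `log p_s`. -/
def logDensity {D : ℕ} (p₀ : EuclideanSpace ℝ (Fin D) → ℝ) (s : ℝ)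
    (x : EuclideanSpace ℝ (Fin D)) : ℝ :=
  Real.log (S.marginal p₀ s x)

/-- The score `∇ log p_s`. -/
def score {D : ℕ} (p₀ : EuclideanSpace ℝ (Fin D) → ℝ) (s : ℝ)
    (x : EuclideanSpace ℝ (Fin D)) : EuclideanSpace ℝ (Fin D) :=
  gradient (S.logDensity p₀ s) x

/-- `∇ Δ log p_s`. -/
def gradLaplacian {D : ℕ} (p₀ : EuclideanSpace ℝ (Fin D) → ℝ) (s : ℝ)
    (x : EuclideanSpace ℝ (Fin D)) : EuclideanSpace ℝ (Fin D) :=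
  gradient (Laplacian.laplacian (S.logDensity p₀ s)) x

/-- `ψ(s)` for the final time `t`; see `psi_eq` for the expression through `λ`. In this form it
also makes sense when `σ s = 0`, where it is the limit of that expression. -/
def psi (t s : ℝ) : ℝ := S.transMean s t ^ 2 / S.transVar s t

/-- `A(s, y) = ∇² log p_s (y) - ψ(s) I`. -/
def hessA {D : ℕ} (p₀ : EuclideanSpace ℝ (Fin D) → ℝ) (t s : ℝ)
    (y : EuclideanSpace ℝ (Fin D)) :
    EuclideanSpace ℝ (Fin D) →L[ℝ] EuclideanSpace ℝ (Fin D) :=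
  fderiv ℝ (S.score p₀ s) y - S.psi t s • ContinuousLinearMap.id ℝ (EuclideanSpace ℝ (Fin D))

/-- `ψ(s) = (1 / σ_s²) e^{λ_t} / (e^{λ_s} - e^{λ_t})` wherever `λ_s` is finite. -/
theorem psi_eq {s t : ℝ} (hs : s ∈ Icc 0 T) (hst : s < t) (ht : t ≤ T) (hσ : 0 < S.σ s) :
    S.psi t s = 1 / S.σ s ^ 2 *
      (Real.exp (S.logSNR t) / (Real.exp (S.logSNR s) - Real.exp (S.logSNR t))) := by
  have ht' : t ∈ Icc 0 T := ⟨hs.1.trans hst.le, ht⟩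
  have hαs := S.α_pos s hs
  have hαt := S.α_pos t ht'
  have hσt := S.σ_pos t ⟨hs.1.trans_lt hst, ht⟩
  have hmono : S.σ s ^ 2 / S.α s ^ 2 < S.σ t ^ 2 / S.α t ^ 2 := S.snr_decreasing hs ht' hst
  rw [div_lt_div_iff₀ (by positivity) (by positivity)] at hmono
  have h1 : S.σ t ^ 2 * S.α s ^ 2 - S.σ s ^ 2 * S.α t ^ 2 ≠ 0 := by linarith
  have e1 : S.transVar s t =
      (S.σ t ^ 2 * S.α s ^ 2 - S.σ s ^ 2 * S.α t ^ 2) / S.α s ^ 2 := by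
    unfold transVar transMean; field_simp
  have e2 : S.α s ^ 2 / S.σ s ^ 2 - S.α t ^ 2 / S.σ t ^ 2 =
      (S.σ t ^ 2 * S.α s ^ 2 - S.σ s ^ 2 * S.α t ^ 2) / (S.σ s ^ 2 * S.σ t ^ 2) := by
    field_simp
  unfold psi logSNR
  rw [Real.exp_log (by positivity), Real.exp_log (by positivity), e1, e2]
  unfold transMean
  field_simp

/-- With `α_0 = 1` and `σ_0 = 0` one has `p_{t|0}(x | z) = N(x; α_t z, σ_t² I)`. -/
theorem transDensity_zero {D : ℕ} (hα : S.α 0 = 1) (hσ : S.σ 0 = 0) (t : ℝ)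
    (x z : EuclideanSpace ℝ (Fin D)) :
    S.transDensity 0 t x z = gaussianDensity (S.α t • z) (S.σ t ^ 2) x := by
  simp [transDensity, transVar, transMean, hα, hσ]

end NoiseSchedule

end ModeTracking

end

/-! Measured in units of the signal level, the diffusion is a heat flow. Put `m s = S.transMean 0
s`, `v s = S.scaledVar s`, `τ = v t`, `a = (m t)⁻¹ • xt` and `w s = (m s)⁻¹ • y s`. Then `p_s(x)` is
`(m s)⁻ᴰ K_{v s}(x / m s)`, where `K_v = heatFlow p₀ v` is `p₀` convolved with a Gaussian of
variance `v` (`marginal_eq`). Up to a positive factor independent of the space variable, the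
denoising density is `exp(-‖u - a‖² / (2(τ - v s))) K_{v s}(u)` at `u = x / m s`
(`exists_denoising_eq`).

A mode `w` is therefore a critical point: `∇K = (K / (τ - v)) (w - a)`. For `0 < s < t` this
identity is differentiated along the curve. The heat equation `∂_v K = ½ ΔK`, together with its
gradient `∂_v ∇K = ½ ∇ΔK`, turns the time derivatives into space derivatives; eliminating `w - a` by
the identity itself and passing to `log K` gives the equation (`heatFlow_mode_equation`). Scaling
back by `m s` gives the statement for `p_s`, since `v' = g² / m²` and `m' = f m`.

At `s = 0` the equation and the maximality are obtained as limits. This requires the value,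
gradient, Hessian and gradient of the Laplacian of `K_v` to converge to those of `p₀`, jointly in
`v` and the point (`tendsto_heatFlow`). Since `p₀` is only integrable and `C³`, with no bounds at
infinity, it is split by a bump function: on the compactly supported part derivatives can be moved
onto the datum, and the rest is killed by Gaussian decay.

At `s = t` the Gaussian factor concentrates at `a`, and positivity of `K_τ(a)` forces `w t = a`
(`eq_of_isMaxOn_gaussianTilt`). -/

namespace ModeTracking

/-! ### Derivatives of `log k`, and of rescaled functions, through third order. -/

section LogDerivatives

variable {E : Type*} [NormedAddCommGroup E] [InnerProductSpace ℝ E] [FiniteDimensional ℝ E]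

/-- The trace of a continuous endomorphism of a Euclidean space. -/
noncomputable def traceCLM (E : Type*) [NormedAddCommGroup E] [InnerProductSpace ℝ E]
    [FiniteDimensional ℝ E] : (E →L[ℝ] E) →L[ℝ] ℝ :=
  ∑ i, (innerSL ℝ (stdOrthonormalBasis ℝ E i)).comp
    (ContinuousLinearMap.apply ℝ E (stdOrthonormalBasis ℝ E i))

theorem traceCLM_apply (A : E →L[ℝ] E) :
    traceCLM E A = ∑ i, inner ℝ (stdOrthonormalBasis ℝ E i) (A (stdOrthonormalBasis ℝ E i)) := by
  simp [traceCLM]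

theorem traceCLM_id :
    traceCLM E (ContinuousLinearMap.id ℝ E) = Module.finrank ℝ E := by
  simp [traceCLM_apply]

theorem traceCLM_smulRight (a b : E) :
    traceCLM E ((innerSL ℝ a).smulRight b) = inner ℝ a b := by
  simp only [traceCLM_apply, ContinuousLinearMap.smulRight_apply, innerSL_apply_apply,
    inner_smul_right]
  rw [← (stdOrthonormalBasis ℝ E).sum_inner_mul_inner a b]

theorem gradient_eq_toDual_symm_comp (k : E → ℝ) :
    gradient k = fun x => (InnerProductSpace.toDual ℝ E).symm (fderiv ℝ k x) := rfl

theorem _root_.ContDiffAt.gradient {k : E → ℝ} {x : E} {n m : ℕ} (hk : ContDiffAt ℝ n k x)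
    (hmn : m + 1 ≤ n) : ContDiffAt ℝ m (gradient k) x := by
  rw [gradient_eq_toDual_symm_comp]
  have h := hk.fderiv_right (m := m) (by exact_mod_cast hmn)
  exact (InnerProductSpace.toDual ℝ E).symm.toContinuousLinearEquiv.contDiff.contDiffAt.comp x h

theorem inner_fderiv_gradient {k : E → ℝ} {x : E} (hk : ContDiffAt ℝ 2 k x) (a b : E) :
    inner ℝ (fderiv ℝ (gradient k) x a) b = fderiv ℝ (fderiv ℝ k) x a b := by
  have h : HasFDerivAt (gradient k) (fderiv ℝ (gradient k) x) x :=
    ((hk.gradient (n := 2) (m := 1) le_rfl).differentiableAt (by simp)).hasFDerivAt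
  have h2 : fderiv ℝ k = fun u => innerSL ℝ (gradient k u) := by
    ext u v
    simp
  have h3 : HasFDerivAt (fun u => innerSL ℝ (gradient k u))
      ((innerSL ℝ).comp (fderiv ℝ (gradient k) x)) x :=
    (innerSL ℝ (E := E)).hasFDerivAt.comp x h
  rw [h2, h3.fderiv]
  rfl

/-- Symmetry of second derivatives, read through the Riesz isomorphism. -/
theorem inner_fderiv_gradient_comm {k : E → ℝ} {x : E} (hk : ContDiffAt ℝ 2 k x) (a b : E) :
    inner ℝ (fderiv ℝ (gradient k) x a) b = inner ℝ a (fderiv ℝ (gradient k) x b) := by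
  rw [real_inner_comm _ a, inner_fderiv_gradient hk, inner_fderiv_gradient hk]
  exact (hk.isSymmSndFDerivAt (by simp)).eq a b

/-- Writing the Laplacian as a continuous linear functional of the Hessian lets it commute with
integrals and limits. -/
theorem laplacian_eq_traceCLM {k : E → ℝ} {x : E} (hk : ContDiffAt ℝ 2 k x) :
    Laplacian.laplacian k x = traceCLM E (fderiv ℝ (gradient k) x) := by
  rw [InnerProductSpace.laplacian_eq_iteratedFDeriv_stdOrthonormalBasis, traceCLM_apply]
  refine Finset.sum_congr rfl fun i _ => ?_
  rw [iteratedFDeriv_two_apply, real_inner_comm, inner_fderiv_gradient hk]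
  simp

theorem laplacian_eventuallyEq_traceCLM {k : E → ℝ} {x : E} (hk : ContDiffAt ℝ 2 k x) :
    Laplacian.laplacian k =ᶠ[𝓝 x] fun u => traceCLM E (fderiv ℝ (gradient k) u) := by
  filter_upwards [hk.eventually (by simp)] with u hu using laplacian_eq_traceCLM hu

theorem hasGradientAt_log {k : E → ℝ} {x : E} (hk : DifferentiableAt ℝ k x) (h0 : 0 < k x) :
    HasGradientAt (fun u => Real.log (k u)) ((k x)⁻¹ • gradient k x) x := by
  have h := hk.hasGradientAt.hasFDerivAt.log h0.ne'
  rw [hasGradientAt_iff_hasFDerivAt]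
  simpa using h

/-- The Hessian of `log k` as a function of the value, gradient and Hessian of `k`. -/
noncomputable def logHess (c : ℝ) (G : E) (H : E →L[ℝ] E) : E →L[ℝ] E :=
  c⁻¹ • H - (c ^ 2)⁻¹ • (innerSL ℝ G).smulRight G

/-- The gradient of the Laplacian of `log k` in terms of the derivatives of `k`. -/
noncomputable def logGradLap (c : ℝ) (G : E) (H : E →L[ℝ] E) (J : E) : E :=
  c⁻¹ • J - ((c ^ 2)⁻¹ * traceCLM E H) • G - (2 : ℝ) • logHess c G H (c⁻¹ • G)

theorem eventually_gradient_log {k : E → ℝ} {x : E} (hk : ContDiffAt ℝ 1 k x) (h0 : 0 < k x) :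
    gradient (fun u => Real.log (k u)) =ᶠ[𝓝 x] fun u => (k u)⁻¹ • gradient k u := by
  filter_upwards [hk.eventually (by simp), hk.continuousAt.eventually (lt_mem_nhds h0)]
    with u hu h0u
  exact (hasGradientAt_log (hu.differentiableAt (by simp)) h0u).gradient

theorem hasFDerivAt_gradient_log {k : E → ℝ} {x : E} (hk : ContDiffAt ℝ 2 k x) (h0 : 0 < k x) :
    HasFDerivAt (gradient (fun u => Real.log (k u)))
      (logHess (k x) (gradient k x) (fderiv ℝ (gradient k) x)) x := by
  have h1 : HasFDerivAt (fun u => (k u)⁻¹) (-(k x ^ 2)⁻¹ • innerSL ℝ (gradient k x)) x := by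
    have := (hasDerivAt_inv h0.ne').comp_hasFDerivAt x
      (hk.differentiableAt (by simp)).hasGradientAt.hasFDerivAt
    exact this
  have h2 : HasFDerivAt (gradient k) (fderiv ℝ (gradient k) x) x :=
    ((hk.gradient (n := 2) (m := 1) le_rfl).differentiableAt (by simp)).hasFDerivAt
  refine ((h1.smul h2).congr_fderiv ?_).congr_of_eventuallyEq
    (eventually_gradient_log (hk.of_le (by norm_num)) h0)
  ext v
  simp [logHess, smul_smul, sub_eq_add_neg]

theorem traceCLM_logHess (c : ℝ) (G : E) (H : E →L[ℝ] E) :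
    traceCLM E (logHess c G H) = c⁻¹ * traceCLM E H - ‖c⁻¹ • G‖ ^ 2 := by
  simp only [logHess, map_sub, map_smul, traceCLM_smulRight, real_inner_self_eq_norm_sq, norm_smul,
    smul_eq_mul, mul_pow, norm_inv, Real.norm_eq_abs, inv_pow, sq_abs]

theorem _root_.ContDiffAt.differentiableAt_laplacian {k : E → ℝ} {x : E}
    (hk : ContDiffAt ℝ 3 k x) : DifferentiableAt ℝ (Laplacian.laplacian k) x := by
  have h1 := (((hk.gradient (n := 3) (m := 2) le_rfl).fderiv_right (m := 1)
    (by norm_num)).differentiableAt (by simp))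
  exact ((traceCLM E).differentiableAt.comp x h1).congr_of_eventuallyEq
    (laplacian_eventuallyEq_traceCLM (hk.of_le (by norm_num)))

/-- Differentiate `Δ log k = Δk / k - ‖∇ log k‖²`; the last term contributes `-2 (∇² log k) ∇ log k`
because the Hessian is symmetric. Asking for `C²` plus a differentiable Laplacian, rather than `C³`,
matches what is proved for the heat flow. -/
theorem hasGradientAt_laplacian_log {k : E → ℝ} {x : E} (hk : ContDiffAt ℝ 2 k x)
    (hlap : DifferentiableAt ℝ (Laplacian.laplacian k) x) (h0 : 0 < k x) :
    HasGradientAt (Laplacian.laplacian (fun u => Real.log (k u)))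
      (logGradLap (k x) (gradient k x) (fderiv ℝ (gradient k) x)
        (gradient (Laplacian.laplacian k) x)) x := by
  have hlogk : ContDiffAt ℝ 2 (fun u => Real.log (k u)) x := hk.log h0.ne'
  have hG := hasFDerivAt_gradient_log hk h0
  have hev : Laplacian.laplacian (fun u => Real.log (k u)) =ᶠ[𝓝 x]
      fun u => (k u)⁻¹ * Laplacian.laplacian k u -
        ‖gradient (fun u => Real.log (k u)) u‖ ^ 2 := by
    filter_upwards [hk.eventually (by simp), hk.continuousAt.eventually (lt_mem_nhds h0)]
      with u hu h0u
    rw [laplacian_eq_traceCLM (hu.log h0u.ne'), (hasFDerivAt_gradient_log hu h0u).fderiv,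
      traceCLM_logHess, laplacian_eq_traceCLM hu,
      (hasGradientAt_log (hu.differentiableAt (by simp)) h0u).gradient]
  have h1 : HasFDerivAt (fun u => (k u)⁻¹) (-(k x ^ 2)⁻¹ • innerSL ℝ (gradient k x)) x :=
    (hasDerivAt_inv h0.ne').comp_hasFDerivAt x
      (hk.differentiableAt (by simp)).hasGradientAt.hasFDerivAt
  have h2 : HasFDerivAt (Laplacian.laplacian k)
    (innerSL ℝ (gradient (Laplacian.laplacian k) x)) x := hlap.hasGradientAt.hasFDerivAt
  refine (((h1.mul h2).sub hG.norm_sq).congr_fderiv ?_).congr_of_eventuallyEq hev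
  have hsymm : ∀ a b, inner ℝ a (logHess (k x) (gradient k x) (fderiv ℝ (gradient k) x) b) =
      inner ℝ (logHess (k x) (gradient k x) (fderiv ℝ (gradient k) x) a) b := fun a b => by
    rw [← hG.fderiv, inner_fderiv_gradient_comm hlogk]
  ext v
  rw [(hasGradientAt_log (hk.differentiableAt (by simp)) h0).gradient]
  simp only [logGradLap, InnerProductSpace.toDual_apply_apply, inner_sub_left, ← hsymm,
    inner_smul_left (𝕜 := ℝ), laplacian_eq_traceCLM hk]
  simp
  ring

/-- In this and the next two lemmas each derivative produces one factor `r`. They apply to `log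
p_s`, which is a constant plus the log of the heat flow at `(m s)⁻¹ • x`. -/
theorem gradient_const_add_comp_smul {l : E → ℝ} (b r : ℝ) {x : E}
    (hl : DifferentiableAt ℝ l (r • x)) :
    gradient (fun u => b + l (r • u)) x = r • gradient l (r • x) := by
  have h1 : HasFDerivAt (fun u : E => r • u) (r • ContinuousLinearMap.id ℝ E) x :=
    (hasFDerivAt_id x).const_smul r
  refine HasGradientAt.gradient ?_
  rw [hasGradientAt_iff_hasFDerivAt]
  refine ((hl.hasGradientAt.hasFDerivAt.comp x h1).const_add b).congr_fderiv ?_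
  ext v
  simp

theorem fderiv_gradient_const_add_comp_smul {l : E → ℝ} (b r : ℝ) {x : E}
    (hl : ContDiffAt ℝ 2 l (r • x)) :
    fderiv ℝ (gradient (fun u => b + l (r • u))) x = r ^ 2 • fderiv ℝ (gradient l) (r • x) := by
  have h1 : HasFDerivAt (fun u : E => r • u) (r • ContinuousLinearMap.id ℝ E) x :=
    (hasFDerivAt_id x).const_smul r
  have h2 : HasFDerivAt (gradient l) (fderiv ℝ (gradient l) (r • x)) (r • x) :=
    ((hl.gradient (n := 2) (m := 1) le_rfl).differentiableAt (by simp)).hasFDerivAt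
  have hev : gradient (fun u => b + l (r • u)) =ᶠ[𝓝 x] fun u => r • gradient l (r • u) := by
    filter_upwards [h1.continuousAt.eventually (hl.eventually (by simp))] with u hu
    exact gradient_const_add_comp_smul b r (hu.differentiableAt (by simp))
  rw [hev.fderiv_eq]
  refine (((h2.comp x h1).const_smul r).congr_fderiv ?_).fderiv
  ext1 v
  simp [smul_smul, pow_two]

theorem gradient_laplacian_const_add_comp_smul {l : E → ℝ} (b r : ℝ) {x : E}
    (hl : ContDiffAt ℝ 2 l (r • x))
    (hlap : DifferentiableAt ℝ (Laplacian.laplacian l) (r • x)) :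
    gradient (Laplacian.laplacian (fun u => b + l (r • u))) x =
      r ^ 3 • gradient (Laplacian.laplacian l) (r • x) := by
  have hc : ContDiff ℝ 2 (fun u : E => r • u) := contDiff_const_smul r
  have hev : Laplacian.laplacian (fun u => b + l (r • u)) =ᶠ[𝓝 x]
      fun u => r ^ 2 * Laplacian.laplacian l (r • u) := by
    filter_upwards [hc.continuous.continuousAt.eventually (hl.eventually (by simp))] with u hu
    have hu' : ContDiffAt ℝ 2 (fun u => b + l (r • u)) u :=
      contDiffAt_const.add (hu.comp u hc.contDiffAt)
    rw [laplacian_eq_traceCLM hu',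
      fderiv_gradient_const_add_comp_smul b r hu, laplacian_eq_traceCLM hu]
    simp
  have h1 : HasFDerivAt (fun u : E => r • u) (r • ContinuousLinearMap.id ℝ E) x :=
    (hasFDerivAt_id x).const_smul r
  refine HasGradientAt.gradient ?_
  rw [hasGradientAt_iff_hasFDerivAt]
  refine (((hlap.hasGradientAt.hasFDerivAt.comp x h1).const_mul (r ^ 2)).congr_fderiv
    ?_).congr_of_eventuallyEq hev
  ext v
  simp
  ring

end LogDerivatives

/-! ### The heat kernel and its heat equation. -/

section HeatKernel

variable {D : ℕ}

/-- The heat kernel on `ℝ^D` with variance `v`. -/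
noncomputable def heatKernel (v : ℝ) (x : EuclideanSpace ℝ (Fin D)) : ℝ :=
  (√(2 * π * v) ^ D)⁻¹ * Real.exp (-‖x‖ ^ 2 / (2 * v))

theorem heatKernel_pos {v : ℝ} (hv : 0 < v) (x : EuclideanSpace ℝ (Fin D)) :
    0 < heatKernel v x := by
  unfold heatKernel
  positivity

theorem continuous_heatKernel (v : ℝ) :
    Continuous (heatKernel v : EuclideanSpace ℝ (Fin D) → ℝ) := by
  unfold heatKernel
  fun_prop

/-- The gradient of the heat kernel. -/
noncomputable def heatGrad (v : ℝ) (x : EuclideanSpace ℝ (Fin D)) : EuclideanSpace ℝ (Fin D) :=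
  -(heatKernel v x / v) • x

/-- The Hessian of the heat kernel. -/
noncomputable def heatHess (v : ℝ) (x : EuclideanSpace ℝ (Fin D)) :
    EuclideanSpace ℝ (Fin D) →L[ℝ] EuclideanSpace ℝ (Fin D) :=
  (heatKernel v x / v ^ 2) • (innerSL ℝ x).smulRight x -
    (heatKernel v x / v) • ContinuousLinearMap.id ℝ (EuclideanSpace ℝ (Fin D))

/-- The gradient of the Laplacian of the heat kernel. -/
noncomputable def heatGradLap (v : ℝ) (x : EuclideanSpace ℝ (Fin D)) :
    EuclideanSpace ℝ (Fin D) :=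
  (heatKernel v x * ((D + 2) / v ^ 2 - ‖x‖ ^ 2 / v ^ 3)) • x

theorem continuous_heatGrad (v : ℝ) :
    Continuous (heatGrad v : EuclideanSpace ℝ (Fin D) → _) := by
  have := continuous_heatKernel (D := D) v
  unfold heatGrad
  fun_prop

theorem continuous_heatHess (v : ℝ) :
    Continuous (heatHess v : EuclideanSpace ℝ (Fin D) → _) := by
  have := continuous_heatKernel (D := D) v
  unfold heatHess
  fun_prop

theorem continuous_heatGradLap (v : ℝ) :
    Continuous (heatGradLap v : EuclideanSpace ℝ (Fin D) → _) := by
  have := continuous_heatKernel (D := D) v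
  unfold heatGradLap
  fun_prop

theorem traceCLM_heatHess (v : ℝ) (x : EuclideanSpace ℝ (Fin D)) :
    traceCLM _ (heatHess v x) = heatKernel v x * (‖x‖ ^ 2 / v ^ 2 - D / v) := by
  simp only [heatHess, map_sub, map_smul, traceCLM_smulRight, traceCLM_id,
    real_inner_self_eq_norm_sq, smul_eq_mul, finrank_euclideanSpace, Fintype.card_fin]
  ring

/-- Combine a derivative in the time variable and a derivative in the space variable. -/
noncomputable def timeSpace {F G : Type*} [NormedAddCommGroup F] [NormedSpace ℝ F]
    [NormedAddCommGroup G] [NormedSpace ℝ G] (a : F) (L : G →L[ℝ] F) : ℝ × G →L[ℝ] F :=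
  (ContinuousLinearMap.toSpanSingleton ℝ a).coprod L

theorem timeSpace_apply {F G : Type*} [NormedAddCommGroup F] [NormedSpace ℝ F]
    [NormedAddCommGroup G] [NormedSpace ℝ G] (a : F) (L : G →L[ℝ] F) (p : ℝ × G) :
    timeSpace a L p = p.1 • a + L p.2 := by
  simp [timeSpace]

/-- The heat equation for the kernel: the time component is written as half the trace of the
Hessian. The derivative is joint in variance and position so that it can be composed with a moving
point. -/
theorem hasFDerivAt_heatKernel {v : ℝ} (hv : 0 < v) (x : EuclideanSpace ℝ (Fin D)) :
    HasFDerivAt (fun p : ℝ × EuclideanSpace ℝ (Fin D) => heatKernel p.1 p.2)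
      (timeSpace ((1 / 2) * traceCLM _ (heatHess v x)) (innerSL ℝ (heatGrad v x))) (v, x) := by
  have hpv : 0 < 2 * π * v := by positivity
  have hnum : HasFDerivAt (fun p : ℝ × EuclideanSpace ℝ (Fin D) => p.1)
    (ContinuousLinearMap.fst ℝ ℝ (EuclideanSpace ℝ (Fin D))) (v, x) := hasFDerivAt_fst
  have h2 : HasFDerivAt (fun p : ℝ × EuclideanSpace ℝ (Fin D) => p.2)
    (ContinuousLinearMap.snd ℝ ℝ (EuclideanSpace ℝ (Fin D))) (v, x) := hasFDerivAt_snd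
  have ha : HasDerivAt (fun w : ℝ => (√(2 * π * w) ^ D)⁻¹)
      ((√(2 * π * v) ^ D)⁻¹ * (-(D / (2 * v)))) v := by
    have h3 := (((((hasDerivAt_id v).const_mul (2 * π)).sqrt hpv.ne').pow D)).inv
      (pow_ne_zero D (Real.sqrt_pos.2 hpv).ne')
    refine h3.congr_deriv ?_
    have hs := Real.sqrt_pos.2 hpv
    have hsq : √(2 * π * v) ^ 2 = 2 * π * v := Real.sq_sqrt hpv.le
    simp only [id, Pi.pow_apply, mul_one]
    -- The power rule leaves the natural-number exponent `D - 1`, so dimension zero is separate.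
    rcases D with _ | n
    · simp
    · simp only [Nat.add_sub_cancel]
      field_simp
      linear_combination √(2 * π * v) ^ n * hsq
  have hA := ha.comp_hasFDerivAt (v, x) hnum
  have hB : HasDerivAt (fun w : ℝ => (2 * w)⁻¹) (-(1 / (2 * v ^ 2))) v := by
    refine ((((hasDerivAt_id v).const_mul 2)).inv (by simpa using hv.ne')).congr_deriv ?_
    simp only [id]
    field_simp
  have hB' := hB.comp_hasFDerivAt (v, x) hnum
  have hC := (h2.norm_sq.neg.mul hB').exp
  have := hA.mul hC
  refine (this.congr_of_eventuallyEq (Eventually.of_forall fun p => ?_)).congr_fderiv ?_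
  · simp [heatKernel, div_eq_mul_inv]
  · refine ContinuousLinearMap.ext fun p => ?_
    rw [timeSpace_apply, traceCLM_heatHess]
    simp [heatGrad, heatKernel]
    field_simp
    ring

/-- The gradient of the kernel solves the heat equation as well, so its time component is half of
`∇Δ`. -/
theorem hasFDerivAt_heatGrad {v : ℝ} (hv : 0 < v) (x : EuclideanSpace ℝ (Fin D)) :
    HasFDerivAt (fun p : ℝ × EuclideanSpace ℝ (Fin D) => heatGrad p.1 p.2)
      (timeSpace ((1 / 2 : ℝ) • heatGradLap v x) (heatHess v x)) (v, x) := by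
  have hB : HasDerivAt (fun w : ℝ => w⁻¹) (-(v ^ 2)⁻¹) v := hasDerivAt_inv hv.ne'
  have hB' := hB.comp_hasFDerivAt (v, x) (hasFDerivAt_fst (𝕜 := ℝ) (p := (v, x)))
  have h := (((hasFDerivAt_heatKernel hv x).mul hB').neg).smul
    (hasFDerivAt_snd (𝕜 := ℝ) (p := (v, x)))
  refine h.congr_fderiv ?_
  refine ContinuousLinearMap.ext fun p => ?_
  simp only [timeSpace_apply, traceCLM_heatHess]
  simp [timeSpace_apply, heatGrad, heatGradLap, heatHess, smul_smul, add_smul, neg_smul]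
  match_scalars
  · field_simp
  · field_simp
    ring

theorem hasGradientAt_heatLap {v : ℝ} (hv : 0 < v) (x : EuclideanSpace ℝ (Fin D)) :
    HasGradientAt (fun u => traceCLM _ (heatHess v u)) (heatGradLap v x) x := by
  have h1 : HasFDerivAt (fun u : EuclideanSpace ℝ (Fin D) => heatKernel v u)
      (innerSL ℝ (heatGrad v x)) x := by
    refine ((hasFDerivAt_heatKernel hv x).comp x
      (hasFDerivAt_prodMk_right v x)).congr_fderiv ?_
    ext u
    simp [timeSpace_apply]
  have h2 := h1.mul ((((hasFDerivAt_id x).norm_sq).mul_const ((v ^ 2)⁻¹)).sub_const (D / v))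
  rw [hasGradientAt_iff_hasFDerivAt]
  refine (h2.congr_of_eventuallyEq (Eventually.of_forall fun u => ?_)).congr_fderiv ?_
  · simp [traceCLM_heatHess, div_eq_mul_inv]
  · ext u
    simp [heatGrad, heatGradLap]
    field_simp
    ring

end HeatKernel

/-! ### Uniform bounds on the kernel and its derivatives. -/

section KernelBounds

variable {D : ℕ}

/-- From `rⁿ / n! ≤ exp r` at `r = ‖x‖² / (2 v)`. -/
theorem heatKernel_mul_norm_pow_le {v : ℝ} (hv : 0 < v) (n : ℕ) (x : EuclideanSpace ℝ (Fin D)) :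
    heatKernel v x * ‖x‖ ^ (2 * n) ≤ (√(2 * π * v) ^ D)⁻¹ * ((2 * v) ^ n * n.factorial) := by
  have h := Real.pow_div_factorial_le_exp (‖x‖ ^ 2 / (2 * v)) (by positivity) n
  have h1 : ‖x‖ ^ (2 * n) ≤ (2 * v) ^ n * n.factorial * Real.exp (‖x‖ ^ 2 / (2 * v)) := by
    rw [div_le_iff₀ (by positivity), div_pow, div_le_iff₀ (by positivity), ← pow_mul] at h
    linarith
  have h2 : Real.exp (-‖x‖ ^ 2 / (2 * v)) * Real.exp (‖x‖ ^ 2 / (2 * v)) = 1 := by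
    rw [← Real.exp_add, neg_div, neg_add_cancel, Real.exp_zero]
  unfold heatKernel
  calc _ ≤ (√(2 * π * v) ^ D)⁻¹ * Real.exp (-‖x‖ ^ 2 / (2 * v)) *
        ((2 * v) ^ n * n.factorial * Real.exp (‖x‖ ^ 2 / (2 * v))) := by gcongr
    _ = (√(2 * π * v) ^ D)⁻¹ * ((2 * v) ^ n * n.factorial) *
        (Real.exp (-‖x‖ ^ 2 / (2 * v)) * Real.exp (‖x‖ ^ 2 / (2 * v))) := by ring
    _ = _ := by rw [h2, mul_one]

/-- A common majorant of the heat kernel and its derivatives of order at most three. -/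
noncomputable def heatMajorant (v : ℝ) (x : EuclideanSpace ℝ (Fin D)) : ℝ :=
  (D + 3) * ((1 + v⁻¹) ^ 3 * (1 + ‖x‖) ^ 4) * heatKernel v x

theorem heatMajorant_nonneg {v : ℝ} (hv : 0 < v) (x : EuclideanSpace ℝ (Fin D)) :
    0 ≤ heatMajorant v x := by
  have := (heatKernel_pos hv x).le
  unfold heatMajorant
  positivity

/-- Reduces each bound below to a polynomial in `v⁻¹` and `‖x‖` of degree at most 3 and 4, with
coefficient at most `D + 3`. -/
theorem mul_heatKernel_le_heatMajorant {v : ℝ} (hv : 0 < v) (x : EuclideanSpace ℝ (Fin D))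
    {a b c : ℝ} (hac : a ≤ c) (hbD : b ≤ D + 3) (i j : ℕ) (hi : i ≤ 3) (hj : j ≤ 4)
    (hc : c = b * ((1 + v⁻¹) ^ i * (1 + ‖x‖) ^ j) * heatKernel v x) :
    a ≤ heatMajorant v x := by
  have hk := (heatKernel_pos hv x).le
  have hvi := inv_pos.2 hv
  rw [hc] at hac
  refine hac.trans ?_
  unfold heatMajorant
  gcongr <;> linarith [norm_nonneg x]

theorem norm_heatKernel_le {v : ℝ} (hv : 0 < v) (x : EuclideanSpace ℝ (Fin D)) :
    ‖heatKernel v x‖ ≤ heatMajorant v x := by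
  rw [Real.norm_of_nonneg (heatKernel_pos hv x).le]
  exact mul_heatKernel_le_heatMajorant hv x (b := 1) le_rfl
    (by linarith [Nat.cast_nonneg (α := ℝ) D]) 0 0 (by norm_num) (by norm_num) (by ring)

theorem norm_heatGrad_le {v : ℝ} (hv : 0 < v) (x : EuclideanSpace ℝ (Fin D)) :
    ‖heatGrad v x‖ ≤ heatMajorant v x := by
  have hk := (heatKernel_pos hv x).le
  have hvi := inv_pos.2 hv
  refine mul_heatKernel_le_heatMajorant hv x (b := 1) ?_
    (by linarith [Nat.cast_nonneg (α := ℝ) D]) 1 1 (by norm_num) (by norm_num) rfl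
  rw [heatGrad, norm_smul, norm_neg, Real.norm_of_nonneg (by positivity)]
  calc _ = 1 * (v⁻¹ ^ 1 * ‖x‖ ^ 1) * heatKernel v x := by ring
    _ ≤ _ := by gcongr <;> linarith [norm_nonneg x]

theorem norm_heatHess_le {v : ℝ} (hv : 0 < v) (x : EuclideanSpace ℝ (Fin D)) :
    ‖heatHess v x‖ ≤ heatMajorant v x := by
  have hk := (heatKernel_pos hv x).le
  have hvi := inv_pos.2 hv
  have hX := norm_nonneg x
  refine mul_heatKernel_le_heatMajorant hv x (b := 2) ?_
    (by linarith [Nat.cast_nonneg (α := ℝ) D]) 2 2 (by norm_num) (by norm_num) rfl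
  have h1 : ‖heatHess v x‖ ≤ heatKernel v x / v ^ 2 * (‖x‖ * ‖x‖) + heatKernel v x / v * 1 := by
    refine (norm_sub_le _ _).trans ?_
    rw [norm_smul, norm_smul, Real.norm_of_nonneg (by positivity),
      Real.norm_of_nonneg (by positivity), ContinuousLinearMap.norm_smulRight_apply,
      innerSL_apply_norm]
    gcongr
    exact ContinuousLinearMap.norm_id_le
  refine h1.trans ?_
  calc _ = (v⁻¹ ^ 2 * ‖x‖ ^ 2 + v⁻¹) * heatKernel v x := by field_simp
    _ ≤ _ := by
      gcongr
      nlinarith [mul_nonneg hvi.le hX, sq_nonneg v⁻¹, sq_nonneg ‖x‖,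
        mul_nonneg (sq_nonneg v⁻¹) hX, mul_nonneg (sq_nonneg ‖x‖) hvi.le,
        mul_nonneg (sq_nonneg v⁻¹) (sq_nonneg ‖x‖)]

theorem norm_traceCLM_heatHess_le {v : ℝ} (hv : 0 < v) (x : EuclideanSpace ℝ (Fin D)) :
    ‖traceCLM _ (heatHess v x)‖ ≤ heatMajorant v x := by
  have hk := (heatKernel_pos hv x).le
  have hvi := inv_pos.2 hv
  have hX := norm_nonneg x
  have hD := Nat.cast_nonneg (α := ℝ) D
  refine mul_heatKernel_le_heatMajorant hv x (b := D + 1) ?_ (by linarith) 2 2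
    (by norm_num) (by norm_num) rfl
  rw [traceCLM_heatHess, norm_mul, Real.norm_of_nonneg hk, mul_comm]
  gcongr
  refine (norm_sub_le _ _).trans ?_
  rw [Real.norm_of_nonneg (by positivity), Real.norm_of_nonneg (by positivity)]
  calc _ = D * (v⁻¹ ^ 1 * 1 ^ 2) + 1 * (v⁻¹ ^ 2 * ‖x‖ ^ 2) := by field_simp; ring
    _ ≤ D * ((1 + v⁻¹) ^ 2 * (1 + ‖x‖) ^ 2) + 1 * ((1 + v⁻¹) ^ 2 * (1 + ‖x‖) ^ 2) := by
      gcongr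
      · nlinarith
      · linarith
      · linarith
      · linarith
    _ = _ := by ring

theorem norm_heatGradLap_le {v : ℝ} (hv : 0 < v) (x : EuclideanSpace ℝ (Fin D)) :
    ‖heatGradLap v x‖ ≤ heatMajorant v x := by
  have hk := (heatKernel_pos hv x).le
  have hvi := inv_pos.2 hv
  have hX := norm_nonneg x
  have hD := Nat.cast_nonneg (α := ℝ) D
  refine mul_heatKernel_le_heatMajorant hv x (b := D + 3) ?_ le_rfl 3 3
    (by norm_num) (by norm_num) rfl
  rw [heatGradLap, norm_smul, norm_mul, Real.norm_of_nonneg hk, mul_assoc, mul_comm]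
  refine mul_le_mul_of_nonneg_right ?_ hk
  calc _ ≤ ((D + 2) / v ^ 2 + ‖x‖ ^ 2 / v ^ 3) * ‖x‖ := by
        gcongr
        refine (norm_sub_le _ _).trans ?_
        rw [Real.norm_of_nonneg (by positivity), Real.norm_of_nonneg (by positivity)]
    _ = (D + 2) * (v⁻¹ ^ 2 * ‖x‖ ^ 1) + 1 * (v⁻¹ ^ 3 * ‖x‖ ^ 3) := by field_simp
    _ ≤ (D + 2) * ((1 + v⁻¹) ^ 3 * (1 + ‖x‖) ^ 3) + 1 * ((1 + v⁻¹) ^ 3 * (1 + ‖x‖) ^ 3) := by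
      have h1 : v⁻¹ ^ 2 ≤ (1 + v⁻¹) ^ 3 := by nlinarith [sq_nonneg v⁻¹, pow_pos hvi 3]
      have h2 : ‖x‖ ^ 1 ≤ (1 + ‖x‖) ^ 3 := by nlinarith [sq_nonneg ‖x‖, pow_nonneg hX 3]
      gcongr
      · linarith
      · linarith
    _ = _ := by ring

theorem norm_timeSpace_le {F G : Type*} [NormedAddCommGroup F] [NormedSpace ℝ F]
    [NormedAddCommGroup G] [NormedSpace ℝ G] (a : F) (L : G →L[ℝ] F) :
    ‖timeSpace a L‖ ≤ ‖a‖ + ‖L‖ := by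
  refine ContinuousLinearMap.opNorm_le_bound _ (by positivity) fun p => ?_
  rw [timeSpace_apply, add_mul]
  refine (norm_add_le _ _).trans ?_
  have h1 : ‖p.1‖ ≤ ‖p‖ := norm_fst_le p
  have h2 : ‖p.2‖ ≤ ‖p‖ := norm_snd_le p
  rw [norm_smul, mul_comm]
  gcongr
  exact (L.le_opNorm _).trans (by gcongr)

/-- The moments of order 0 and 4 suffice, as `(1 + r)⁴ ≤ 8 (1 + r⁴)`. -/
theorem exists_heatMajorant_le {a b : ℝ} (ha : 0 < a) :
    ∃ C, ∀ v ∈ Ioo a b, ∀ x : EuclideanSpace ℝ (Fin D), heatMajorant v x ≤ C := by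
  refine ⟨(D + 3) * ((1 + a⁻¹) ^ 3 * (8 * ((√(2 * π * a) ^ D)⁻¹ +
    (√(2 * π * a) ^ D)⁻¹ * ((2 * b) ^ 2 * 2)))), fun v hv x => ?_⟩
  have hv0 : 0 < v := ha.trans hv.1
  have hk := (heatKernel_pos hv0 x).le
  have h0 := heatKernel_mul_norm_pow_le hv0 0 x
  have h4 := heatKernel_mul_norm_pow_le hv0 2 x
  simp only [mul_zero, pow_zero, mul_one, Nat.factorial, Nat.cast_one] at h0
  norm_num at h4
  have h5 : (1 + ‖x‖) ^ 4 ≤ 8 * (1 + ‖x‖ ^ 4) := by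
    nlinarith [sq_nonneg (‖x‖ - 1), sq_nonneg (‖x‖ ^ 2 - 1), sq_nonneg (‖x‖ ^ 2 - ‖x‖),
      norm_nonneg x, sq_nonneg (‖x‖ ^ 2 + ‖x‖)]
  have h6 : (√(2 * π * v) ^ D)⁻¹ ≤ (√(2 * π * a) ^ D)⁻¹ := by
    have := hv.1.le
    gcongr
  have h7 : v⁻¹ ≤ a⁻¹ := by
    have := hv.1.le
    gcongr
  have hb := hv.2.le
  unfold heatMajorant
  calc _ ≤ (D + 3) * ((1 + a⁻¹) ^ 3 * (8 * (1 + ‖x‖ ^ 4))) * heatKernel v x := by gcongr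
    _ = (D + 3) * ((1 + a⁻¹) ^ 3 * (8 * (heatKernel v x + heatKernel v x * ‖x‖ ^ 4))) := by ring
    _ ≤ _ := by
      have h8 : heatKernel v x * ‖x‖ ^ 4 ≤ (√(2 * π * a) ^ D)⁻¹ * ((2 * b) ^ 2 * 2) :=
        h4.trans (by gcongr)
      have h9 := add_le_add (h0.trans h6) h8
      have ha' := inv_pos.2 ha
      refine mul_le_mul_of_nonneg_left (mul_le_mul_of_nonneg_left
        (mul_le_mul_of_nonneg_left h9 (by norm_num)) (by positivity)) (by positivity)

/-- Away from the origin Gaussian decay beats every negative power of `v`. -/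
theorem eventually_heatMajorant_le {ρ ε : ℝ} (hρ : 0 < ρ) (hε : 0 < ε) :
    ∀ᶠ v in 𝓝[>] (0 : ℝ), ∀ x : EuclideanSpace ℝ (Fin D), ρ ≤ ‖x‖ → heatMajorant v x ≤ ε := by
  -- The moment of order `2 (n + 2) = 2 D + 8` gains `v ^ (D + 4)`. The crude normalisation bound `v
  -- ^ (-D)` and the factor `v⁻¹ ^ 3` use up all but one power, leaving `C * v`; of the moment, `‖x‖
  -- ^ 4` absorbs the polynomial and the remaining `‖x‖ ^ (2 D + 4)` is bounded below through `ρ`.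
  set n := D + 2 with hn
  set C : ℝ := (D + 3) * (8 * ((1 + ρ⁻¹) ^ 4 *
    ((ρ ^ (2 * D + 4))⁻¹ * (2 ^ (n + 2) * (n + 2).factorial))))
    with hC
  have hC0 : 0 < C := by positivity
  have hlim : Tendsto (fun v : ℝ => C * v) (𝓝[>] 0) (𝓝 0) := by
    have : Tendsto (fun v : ℝ => C * v) (𝓝 0) (𝓝 (C * 0)) := tendsto_id.const_mul C
    rw [mul_zero] at this
    exact this.mono_left nhdsWithin_le_nhds
  filter_upwards [hlim.eventually (ge_mem_nhds hε), self_mem_nhdsWithin,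
    mem_nhdsWithin_of_mem_nhds (Iio_mem_nhds (zero_lt_one (α := ℝ)))] with v hvε hv0 hv1 x hx
  have hv0 : 0 < v := hv0
  have hv1 : v < 1 := hv1
  refine le_trans ?_ hvε
  have hk := (heatKernel_pos hv0 x).le
  have hxp : 0 < ‖x‖ := hρ.trans_le hx
  have h0 := heatKernel_mul_norm_pow_le hv0 (n + 2) x
  have h1 : (√(2 * π * v) ^ D)⁻¹ ≤ (v ^ D)⁻¹ := by
    gcongr
    refine Real.le_sqrt_of_sq_le ?_
    nlinarith [Real.pi_gt_three]
  have h2 : (1 + v⁻¹) ^ 3 ≤ 8 * (v⁻¹) ^ 3 := by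
    have : 1 ≤ v⁻¹ := (one_le_inv₀ hv0).2 hv1.le
    calc (1 + v⁻¹) ^ 3 ≤ (2 * v⁻¹) ^ 3 := by gcongr; linarith
      _ = _ := by ring
  have h3 : (1 + ‖x‖) ^ 4 ≤ (1 + ρ⁻¹) ^ 4 * ‖x‖ ^ 4 := by
    rw [← mul_pow]
    gcongr
    have : 1 ≤ ρ⁻¹ * ‖x‖ := by
      rw [inv_mul_eq_div, one_le_div hρ]; exact hx
    linarith
  have h4 : heatKernel v x * ‖x‖ ^ 4 ≤
      (ρ ^ (2 * D + 4))⁻¹ * (heatKernel v x * ‖x‖ ^ (2 * (n + 2))) := by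
    have : ‖x‖ ^ (2 * (n + 2)) = ‖x‖ ^ (2 * D + 4) * ‖x‖ ^ 4 := by
      rw [← pow_add]; congr 1
    rw [this, inv_mul_eq_div, le_div_iff₀ (by positivity)]
    have : ρ ^ (2 * D + 4) ≤ ‖x‖ ^ (2 * D + 4) := by gcongr
    calc _ ≤ heatKernel v x * ‖x‖ ^ 4 * ‖x‖ ^ (2 * D + 4) := by gcongr
      _ = _ := by ring
  unfold heatMajorant
  calc _ ≤ (D + 3) * (8 * (v⁻¹) ^ 3 * ((1 + ρ⁻¹) ^ 4 * ‖x‖ ^ 4)) * heatKernel v x := by gcongr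
    _ = (D + 3) * (8 * ((1 + ρ⁻¹) ^ 4 * ((heatKernel v x * ‖x‖ ^ 4)))) * (v⁻¹) ^ 3 := by ring
    _ ≤ (D + 3) * (8 * ((1 + ρ⁻¹) ^ 4 * ((ρ ^ (2 * D + 4))⁻¹ *
          ((v ^ D)⁻¹ * ((2 * v) ^ (n + 2) * (n + 2).factorial))))) * (v⁻¹) ^ 3 := by
      have h5 := h0.trans (mul_le_mul_of_nonneg_right h1
        (by positivity : (0 : ℝ) ≤ (2 * v) ^ (n + 2) * (n + 2).factorial))
      have h6 := h4.trans (mul_le_mul_of_nonneg_left h5 (by positivity))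
      refine mul_le_mul_of_nonneg_right (mul_le_mul_of_nonneg_left
        (mul_le_mul_of_nonneg_left (mul_le_mul_of_nonneg_left h6 (by positivity))
          (by norm_num)) (by positivity)) (by positivity)
    _ = C * ((v ^ (n + 2)) * ((v ^ D)⁻¹ * (v⁻¹) ^ 3)) := by rw [hC, mul_pow]; ring
    _ = C * v := by
      rw [hn]
      congr 1
      field_simp
      ring

end KernelBounds

/-! ### Integrals against an integrable weight. -/

section Smear

variable {E F G H : Type*} [NormedAddCommGroup E] [MeasurableSpace E] [BorelSpace E]
  [NormedAddCommGroup F] [NormedSpace ℝ F] [NormedAddCommGroup G] [NormedSpace ℝ G]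
  [NormedAddCommGroup H] [NormedSpace ℝ H] {μ : Measure E} {q : E → ℝ}

theorem integrable_smul_of_bounded [SecondCountableTopology F] (hq : Integrable q μ) {φ : E → F}
    (hφ : Continuous φ) {C : ℝ} (hC : ∀ z, ‖φ z‖ ≤ C) : Integrable (fun z => q z • φ z) μ := by
  refine (hq.norm.mul_const C).mono' (hq.aestronglyMeasurable.smul hφ.aestronglyMeasurable)
    (Eventually.of_forall fun z => ?_)
  rw [norm_smul]
  exact mul_le_mul_of_nonneg_left (hC z) (norm_nonneg _)

/-- Differentiation under an integral against an integrable weight, for a family with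
bounded derivative. -/
theorem hasFDerivAt_integral_smul [SecondCountableTopology F]
    [SecondCountableTopology (G →L[ℝ] F)]
    (hq : Integrable q μ) {φ : G → E → F} {φ' : G → E → G →L[ℝ] F} {p : G} {U : Set G}
    (hU : U ∈ 𝓝 p) (hφ : ∀ y ∈ U, Continuous (φ y)) (hφ' : Continuous (φ' p)) {C : ℝ}
    (hC : ∀ z, ‖φ p z‖ ≤ C) (hC' : ∀ y ∈ U, ∀ z, ‖φ' y z‖ ≤ C)
    (hd : ∀ y ∈ U, ∀ z, HasFDerivAt (fun y => φ y z) (φ' y z) y) :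
    HasFDerivAt (fun y => ∫ z, q z • φ y z ∂μ) (∫ z, q z • φ' p z ∂μ) p := by
  refine hasFDerivAt_integral_of_dominated_of_fderiv_le (F' := fun y z => q z • φ' y z)
    (bound := fun z => ‖q z‖ * C) hU ?_
    (integrable_smul_of_bounded hq (hφ p (mem_of_mem_nhds hU)) hC) ?_ ?_
    (hq.norm.mul_const C) ?_
  · filter_upwards [hU] with y hy
    exact hq.aestronglyMeasurable.smul (hφ y hy).aestronglyMeasurable
  · exact hq.aestronglyMeasurable.smul hφ'.aestronglyMeasurable
  · refine Eventually.of_forall fun z y hy => ?_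
    rw [norm_smul]
    exact mul_le_mul_of_nonneg_left (hC' y hy z) (norm_nonneg _)
  · exact Eventually.of_forall fun z y hy => (hd y hy z).const_smul (q z)

theorem clm_integral_smul [SecondCountableTopology F] [CompleteSpace F] [CompleteSpace H]
    (hq : Integrable q μ) {φ : E → F}
    (hφ : Continuous φ) {C : ℝ} (hC : ∀ z, ‖φ z‖ ≤ C) (L : F →L[ℝ] H) :
    ∫ z, q z • L (φ z) ∂μ = L (∫ z, q z • φ z ∂μ) := by
  rw [← L.integral_comp_comm (integrable_smul_of_bounded hq hφ hC)]
  simp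

end Smear

/-! ### Differentiating the convolution of a weight with the heat kernel. -/

section HeatFlow

variable {D : ℕ} {q : EuclideanSpace ℝ (Fin D) → ℝ}

/-- Convolution of a weight `q` with a kernel `Ψ`. -/
noncomputable def smear {F : Type*} [NormedAddCommGroup F] [NormedSpace ℝ F]
    (q : EuclideanSpace ℝ (Fin D) → ℝ) (Ψ : EuclideanSpace ℝ (Fin D) → F)
    (u : EuclideanSpace ℝ (Fin D)) : F :=
  ∫ z, q z • Ψ (u - z)

theorem norm_timeSpace_heatKernel_le {v C : ℝ} (hv : 0 < v) (x : EuclideanSpace ℝ (Fin D))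
    (hC : heatMajorant v x ≤ C) :
    ‖timeSpace ((1 / 2) * traceCLM _ (heatHess v x)) (innerSL ℝ (heatGrad v x))‖ ≤ 2 * C := by
  refine (norm_timeSpace_le _ _).trans ?_
  have h1 := norm_traceCLM_heatHess_le hv x
  have h2 := norm_heatGrad_le hv x
  rw [innerSL_apply_norm, norm_mul]
  norm_num
  norm_num at h1
  have := abs_nonneg (traceCLM _ (heatHess v x))
  linarith

theorem norm_timeSpace_heatGrad_le {v C : ℝ} (hv : 0 < v) (x : EuclideanSpace ℝ (Fin D))
    (hC : heatMajorant v x ≤ C) :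
    ‖timeSpace ((1 / 2 : ℝ) • heatGradLap v x) (heatHess v x)‖ ≤ 2 * C := by
  refine (norm_timeSpace_le _ _).trans ?_
  have h1 := norm_heatGradLap_le hv x
  have h2 := norm_heatHess_le hv x
  rw [norm_smul]
  norm_num
  have := norm_nonneg (heatGradLap v x)
  linarith

theorem continuous_timeSpace {F G X : Type*} [NormedAddCommGroup F] [NormedSpace ℝ F]
    [NormedAddCommGroup G] [NormedSpace ℝ G] [TopologicalSpace X] {a : X → F} {L : X → G →L[ℝ] F}
    (ha : Continuous a) (hL : Continuous L) : Continuous fun x => timeSpace (a x) (L x) := by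
  have h : (fun x => timeSpace (a x) (L x)) = fun x =>
      (((ContinuousLinearMap.smulRightL ℝ (ℝ × G) F) (ContinuousLinearMap.fst ℝ ℝ G)) (a x)) +
        (L x).comp (ContinuousLinearMap.snd ℝ ℝ G) := by
    funext x
    ext <;> simp [timeSpace_apply]
  rw [h]
  fun_prop

/-- The window of variances stays away from zero, so one constant dominates all kernels in it; this
is the domination used to differentiate in `v`. -/
theorem exists_bound_near {v : ℝ} (hv : 0 < v) :
    ∃ C, 0 ≤ C ∧ ∀ w ∈ Ioo (v / 2) (2 * v), ∀ x : EuclideanSpace ℝ (Fin D),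
      heatMajorant w x ≤ C := by
  obtain ⟨C, hC⟩ := exists_heatMajorant_le (D := D) (a := v / 2) (b := 2 * v) (by positivity)
  exact ⟨C, (heatMajorant_nonneg hv 0).trans (hC v ⟨by linarith, by linarith⟩ 0), hC⟩

theorem smear_congr_clm {F H : Type*} [NormedAddCommGroup F] [NormedSpace ℝ F] [CompleteSpace F]
    [SecondCountableTopology F] [NormedAddCommGroup H] [NormedSpace ℝ H] [CompleteSpace H]
    (hq : Integrable q) {Ψ : EuclideanSpace ℝ (Fin D) → F} (hΨ : Continuous Ψ) {C : ℝ}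
    (hC : ∀ z, ‖Ψ z‖ ≤ C) (L : F →L[ℝ] H) (u : EuclideanSpace ℝ (Fin D)) :
    smear q (fun x => L (Ψ x)) u = L (smear q Ψ u) :=
  clm_integral_smul hq (φ := fun z => Ψ (u - z)) (by fun_prop) (fun z => hC _) L

theorem smear_timeSpace {F : Type*} [NormedAddCommGroup F] [NormedSpace ℝ F]
    [SecondCountableTopology F] [CompleteSpace F]
    [SecondCountableTopology (EuclideanSpace ℝ (Fin D) →L[ℝ] F)]
    (hq : Integrable q) {a : EuclideanSpace ℝ (Fin D) → F}
    {L : EuclideanSpace ℝ (Fin D) → EuclideanSpace ℝ (Fin D) →L[ℝ] F}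
    (ha : Continuous a) (hL : Continuous L) {C : ℝ} (hCa : ∀ z, ‖a z‖ ≤ C) (hCL : ∀ z, ‖L z‖ ≤ C)
    (u : EuclideanSpace ℝ (Fin D)) :
    smear q (fun x => timeSpace (a x) (L x)) u = timeSpace (smear q a u) (smear q L u) := by
  -- `timeSpace` as a continuous linear map of the pair, so that it can be pulled out of a single
  -- integral of pairs.
  set M : F × (EuclideanSpace ℝ (Fin D) →L[ℝ] F) →L[ℝ] (ℝ × EuclideanSpace ℝ (Fin D) →L[ℝ] F) :=
    (((ContinuousLinearMap.smulRightL ℝ (ℝ × EuclideanSpace ℝ (Fin D)) F)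
      (ContinuousLinearMap.fst ℝ ℝ _))).comp (ContinuousLinearMap.fst ℝ _ _) +
    (((ContinuousLinearMap.compL ℝ (ℝ × EuclideanSpace ℝ (Fin D)) (EuclideanSpace ℝ (Fin D)) F).flip
      (ContinuousLinearMap.snd ℝ ℝ _))).comp (ContinuousLinearMap.snd ℝ _ _) with hM
  have hMa : ∀ (b : F) (K : EuclideanSpace ℝ (Fin D) →L[ℝ] F), M (b, K) = timeSpace b K := by
    intro b K
    ext <;> simp [hM, timeSpace_apply]
  have h := smear_congr_clm hq (Ψ := fun x => (a x, L x)) (by fun_prop) (C := C)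
    (fun z => max_le (hCa z) (hCL z)) M u
  have h3 : smear q (fun x => (a x, L x)) u = (smear q a u, smear q L u) :=
    integral_pair (f := fun z => q z • a (u - z)) (g := fun z => q z • L (u - z))
    (integrable_smul_of_bounded hq (φ := fun z => a (u - z)) (by fun_prop) (fun z => hCa _))
    (integrable_smul_of_bounded hq (φ := fun z => L (u - z)) (by fun_prop) (fun z => hCL _))
  simp only [hMa, h3] at h
  exact h

theorem smear_traceCLM_heatHess (hq : Integrable q) {v : ℝ} (hv : 0 < v)
    (u : EuclideanSpace ℝ (Fin D)) :
    smear q (fun x => traceCLM _ (heatHess v x)) u = traceCLM _ (smear q (heatHess v) u) := by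
  obtain ⟨C, -, hC⟩ := exists_bound_near (D := D) hv
  exact smear_congr_clm hq (continuous_heatHess v)
    (fun x => (norm_heatHess_le hv x).trans (hC v ⟨by linarith, by linarith⟩ x)) _ u

/-- The heat equation for the heat flow of an integrable function. -/
theorem hasFDerivAt_smear_heatKernel (hq : Integrable q) {v : ℝ} (hv : 0 < v)
    (u : EuclideanSpace ℝ (Fin D)) :
    HasFDerivAt (fun p : ℝ × EuclideanSpace ℝ (Fin D) => smear q (heatKernel p.1) p.2)
      (timeSpace ((1 / 2) * traceCLM _ (smear q (heatHess v) u))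
        (innerSL ℝ (smear q (heatGrad v) u))) (v, u) := by
  obtain ⟨C, hC0, hC⟩ := exists_bound_near (D := D) hv
  have hvm : v ∈ Ioo (v / 2) (2 * v) := ⟨by linarith, by linarith⟩
  have hpos : ∀ w ∈ Ioo (v / 2) (2 * v), 0 < w := fun w hw => by linarith [hw.1]
  have hca : Continuous fun x : EuclideanSpace ℝ (Fin D) =>
      (1 / 2) * traceCLM _ (heatHess v x) := by
    have := continuous_heatHess (D := D) v
    fun_prop
  have hcL : Continuous fun x : EuclideanSpace ℝ (Fin D) => innerSL ℝ (heatGrad v x) := by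
    have := continuous_heatGrad (D := D) v
    fun_prop
  have h := hasFDerivAt_integral_smul (μ := volume) hq (p := (v, u))
    (φ := fun p z => heatKernel p.1 (p.2 - z))
    (φ' := fun p z => timeSpace ((1 / 2) * traceCLM _ (heatHess p.1 (p.2 - z)))
      (innerSL ℝ (heatGrad p.1 (p.2 - z)))) (U := Ioo (v / 2) (2 * v) ×ˢ univ) (C := 2 * C)
    (prod_mem_nhds (Ioo_mem_nhds hvm.1 hvm.2) univ_mem)
    (fun p _ => by
      have := continuous_heatKernel (D := D) p.1
      fun_prop)
    ((continuous_timeSpace hca hcL).comp (continuous_sub_left u))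
    (fun z => by linarith [norm_heatKernel_le hv (u - z), hC v hvm (u - z)])
    (fun p hp z => norm_timeSpace_heatKernel_le (hpos _ hp.1) _ (hC _ hp.1 _))
    (fun p hp z => by
      have h1 : HasFDerivAt (fun y : ℝ × EuclideanSpace ℝ (Fin D) => (y.1, y.2 - z))
        (ContinuousLinearMap.id ℝ (ℝ × EuclideanSpace ℝ (Fin D))) p :=
        (hasFDerivAt_fst.prodMk (hasFDerivAt_snd.sub_const z)).congr_fderiv (by ext <;> simp)
      exact HasFDerivAt.comp p (hasFDerivAt_heatKernel (hpos _ hp.1) (p.2 - z)) h1)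
  refine h.congr_fderiv ?_
  have h2 := smear_timeSpace hq hca hcL (C := C)
    (fun z => by
      have h1 := norm_traceCLM_heatHess_le hv z
      rw [norm_mul]
      norm_num
      norm_num at h1
      have := abs_nonneg (traceCLM _ (heatHess v z))
      linarith [hC v hvm z])
    (fun z => by
      rw [innerSL_apply_norm]
      exact (norm_heatGrad_le hv z).trans (hC v hvm z)) u
  refine h2.trans ?_
  congr 1
  · rw [← smear_traceCLM_heatHess hq hv, smear, smear, ← integral_const_mul]
    congr 1
    funext z
    simp only [smul_eq_mul]
    ring
  · exact smear_congr_clm hq (continuous_heatGrad v)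
      (fun z => (norm_heatGrad_le hv z).trans (hC v hvm z)) (innerSL ℝ) u

theorem hasFDerivAt_smear_heatGrad (hq : Integrable q) {v : ℝ} (hv : 0 < v)
    (u : EuclideanSpace ℝ (Fin D)) :
    HasFDerivAt (fun p : ℝ × EuclideanSpace ℝ (Fin D) => smear q (heatGrad p.1) p.2)
      (timeSpace ((1 / 2 : ℝ) • smear q (heatGradLap v) u) (smear q (heatHess v) u)) (v, u) := by
  obtain ⟨C, hC0, hC⟩ := exists_bound_near (D := D) hv
  have hvm : v ∈ Ioo (v / 2) (2 * v) := ⟨by linarith, by linarith⟩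
  have hpos : ∀ w ∈ Ioo (v / 2) (2 * v), 0 < w := fun w hw => by linarith [hw.1]
  have hca : Continuous fun x : EuclideanSpace ℝ (Fin D) => (1 / 2 : ℝ) • heatGradLap v x := by
    have := continuous_heatGradLap (D := D) v
    fun_prop
  have hcL := continuous_heatHess (D := D) v
  have h := hasFDerivAt_integral_smul (μ := volume) hq (p := (v, u))
    (φ := fun p z => heatGrad p.1 (p.2 - z))
    (φ' := fun p z => timeSpace ((1 / 2 : ℝ) • heatGradLap p.1 (p.2 - z))
      (heatHess p.1 (p.2 - z))) (U := Ioo (v / 2) (2 * v) ×ˢ univ) (C := 2 * C)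
    (prod_mem_nhds (Ioo_mem_nhds hvm.1 hvm.2) univ_mem)
    (fun p _ => by
      have := continuous_heatGrad (D := D) p.1
      fun_prop)
    ((continuous_timeSpace hca hcL).comp (continuous_sub_left u))
    (fun z => by linarith [norm_heatGrad_le hv (u - z), hC v hvm (u - z)])
    (fun p hp z => norm_timeSpace_heatGrad_le (hpos _ hp.1) _ (hC _ hp.1 _))
    (fun p hp z => by
      have h1 : HasFDerivAt (fun y : ℝ × EuclideanSpace ℝ (Fin D) => (y.1, y.2 - z))
        (ContinuousLinearMap.id ℝ (ℝ × EuclideanSpace ℝ (Fin D))) p :=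
        (hasFDerivAt_fst.prodMk (hasFDerivAt_snd.sub_const z)).congr_fderiv (by ext <;> simp)
      exact HasFDerivAt.comp p (hasFDerivAt_heatGrad (hpos _ hp.1) (p.2 - z)) h1)
  refine h.congr_fderiv ?_
  have h2 := smear_timeSpace hq hca hcL (C := C)
    (fun z => by
      have h1 := norm_heatGradLap_le hv z
      rw [norm_smul]
      norm_num
      have := norm_nonneg (heatGradLap v z)
      linarith [hC v hvm z])
    (fun z => (norm_heatHess_le hv z).trans (hC v hvm z)) u
  refine h2.trans ?_
  congr 1
  exact smear_congr_clm hq (continuous_heatGradLap v)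
      (fun z => (norm_heatGradLap_le hv z).trans (hC v hvm z))
      ((1 / 2 : ℝ) • ContinuousLinearMap.id ℝ _) u

theorem hasGradientAt_smear_heatKernel (hq : Integrable q) {v : ℝ} (hv : 0 < v)
    (u : EuclideanSpace ℝ (Fin D)) :
    HasGradientAt (smear q (heatKernel v)) (smear q (heatGrad v) u) u := by
  rw [hasGradientAt_iff_hasFDerivAt]
  refine ((hasFDerivAt_smear_heatKernel hq hv u).comp u
    (hasFDerivAt_prodMk_right v u)).congr_fderiv ?_
  ext x
  simp [timeSpace_apply]

theorem hasFDerivAt_smear_heatGrad_space (hq : Integrable q) {v : ℝ} (hv : 0 < v)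
    (u : EuclideanSpace ℝ (Fin D)) :
    HasFDerivAt (smear q (heatGrad v)) (smear q (heatHess v) u) u := by
  refine ((hasFDerivAt_smear_heatGrad hq hv u).comp u
    (hasFDerivAt_prodMk_right v u)).congr_fderiv ?_
  ext1 x
  simp [timeSpace_apply]

/-- Taking the trace before differentiating avoids the full third-derivative tensor. -/
theorem hasGradientAt_traceCLM_smear_heatHess (hq : Integrable q) {v : ℝ} (hv : 0 < v)
    (u : EuclideanSpace ℝ (Fin D)) :
    HasGradientAt (fun x => traceCLM _ (smear q (heatHess v) x)) (smear q (heatGradLap v) u) u := by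
  obtain ⟨C, hC0, hC⟩ := exists_bound_near (D := D) hv
  have hvm : v ∈ Ioo (v / 2) (2 * v) := ⟨by linarith, by linarith⟩
  have hc := continuous_heatHess (D := D) v
  have hcL : Continuous fun x : EuclideanSpace ℝ (Fin D) => innerSL ℝ (heatGradLap v x) := by
    have := continuous_heatGradLap (D := D) v
    fun_prop
  have h := hasFDerivAt_integral_smul (μ := volume) hq (p := u)
    (φ := fun p z => traceCLM _ (heatHess v (p - z)))
    (φ' := fun p z => innerSL ℝ (heatGradLap v (p - z))) (U := univ) (C := C) univ_mem
    (fun p _ => by fun_prop) (hcL.comp (continuous_sub_left u))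
    (fun z => (norm_traceCLM_heatHess_le hv _).trans (hC v hvm _))
    (fun p _ z => by
      rw [innerSL_apply_norm]
      exact (norm_heatGradLap_le hv _).trans (hC v hvm _))
    (fun p _ z => by
      have h1 : HasFDerivAt (fun y : EuclideanSpace ℝ (Fin D) => y - z)
        (ContinuousLinearMap.id ℝ (EuclideanSpace ℝ (Fin D))) p := (hasFDerivAt_id p).sub_const z
      exact HasFDerivAt.comp p (hasGradientAt_heatLap hv (p - z)).hasFDerivAt h1)
  rw [hasGradientAt_iff_hasFDerivAt]
  refine (h.congr_fderiv ?_).congr_of_eventuallyEq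
    (Eventually.of_forall fun x => (smear_traceCLM_heatHess hq hv x).symm)
  exact smear_congr_clm hq (continuous_heatGradLap v)
      (fun z => (norm_heatGradLap_le hv z).trans (hC v hvm z)) (innerSL ℝ) u

end HeatFlow

/-! ### The heat flow as the variance tends to zero. -/

section HeatLimit

variable {D : ℕ} {q : EuclideanSpace ℝ (Fin D) → ℝ}

theorem integrable_heatKernel {v : ℝ} (hv : 0 < v) :
    Integrable (heatKernel v : EuclideanSpace ℝ (Fin D) → ℝ) := by
  have h := (GaussianFourier.integrable_cexp_neg_mul_sq_norm_add (V := EuclideanSpace ℝ (Fin D))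
    (b := ((1 / (2 * v) : ℝ) : ℂ)) (by simpa using hv) 0 0).re
  refine (h.const_mul ((√(2 * π * v) ^ D)⁻¹)).congr (Eventually.of_forall fun x => ?_)
  simp only [heatKernel]
  congr 1
  have : -(((1 / (2 * v) : ℝ) : ℂ)) * (‖x‖ : ℂ) ^ 2 +
      0 * ((inner ℝ (0 : EuclideanSpace ℝ (Fin D)) x : ℝ) : ℂ) =
      ((-‖x‖ ^ 2 / (2 * v) : ℝ) : ℂ) := by
    push_cast
    ring
  rw [this, ← Complex.ofReal_exp]
  exact Complex.ofReal_re _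

theorem integral_heatKernel {v : ℝ} (hv : 0 < v) :
    ∫ x : EuclideanSpace ℝ (Fin D), heatKernel v x = 1 := by
  have h := GaussianFourier.integral_rexp_neg_mul_sq_norm (V := EuclideanSpace ℝ (Fin D))
    (b := 1 / (2 * v)) (by positivity)
  have h1 : ∀ x : EuclideanSpace ℝ (Fin D), heatKernel v x =
      (√(2 * π * v) ^ D)⁻¹ * Real.exp (-(1 / (2 * v)) * ‖x‖ ^ 2) := by
    intro x
    rw [heatKernel]
    congr 2
    ring
  simp_rw [h1]
  rw [integral_const_mul, h, finrank_euclideanSpace, Fintype.card_fin]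
  have h2 : π / (1 / (2 * v)) = 2 * π * v := by field_simp
  rw [h2, Real.sqrt_eq_rpow, ← Real.rpow_natCast, ← Real.rpow_mul (by positivity),
    one_div_mul_eq_div]
  exact inv_mul_cancel₀ (by positivity)

theorem heatKernel_smul_sqrt {v : ℝ} (hv : 0 < v) (x : EuclideanSpace ℝ (Fin D)) :
    heatKernel v (√v • x) = (√v ^ D)⁻¹ * heatKernel 1 x := by
  have hs := Real.sqrt_pos.2 hv
  rw [heatKernel, heatKernel, Real.sqrt_mul (by positivity) v, mul_one, mul_pow, norm_smul,
    Real.norm_of_nonneg hs.le, mul_pow, Real.sq_sqrt hv.le, mul_inv]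
  have : -(v * ‖x‖ ^ 2) / (2 * v) = -‖x‖ ^ 2 / (2 * 1) := by field_simp
  rw [this]
  ring

/-- The substitution `z ↦ √v • z` fixes the Gaussian weight and moves `v` into the argument of `Q`,
where dominated convergence can treat `v → 0`. -/
theorem smear_heatKernel_eq {F : Type*} [NormedAddCommGroup F] [NormedSpace ℝ F]
    (Q : EuclideanSpace ℝ (Fin D) → F) {v : ℝ} (hv : 0 < v) (u : EuclideanSpace ℝ (Fin D)) :
    smear (heatKernel v) Q u = ∫ z, heatKernel 1 z • Q (u - √v • z) := by
  have hs := Real.sqrt_pos.2 hv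
  have h := Measure.integral_comp_smul (volume : Measure (EuclideanSpace ℝ (Fin D)))
    (fun z => heatKernel v z • Q (u - z)) (√v)
  simp only [heatKernel_smul_sqrt hv, finrank_euclideanSpace, Fintype.card_fin, mul_smul] at h
  rw [integral_smul, abs_of_pos (by positivity)] at h
  exact (smul_right_injective F (inv_pos.2 (pow_pos hs D)).ne' h).symm

theorem tendsto_smear_heatKernel {F : Type*} [NormedAddCommGroup F] [NormedSpace ℝ F]
    [SecondCountableTopology F] [CompleteSpace F]
    {Q : EuclideanSpace ℝ (Fin D) → F} (hQ : Continuous Q) {C : ℝ} (hC : ∀ x, ‖Q x‖ ≤ C)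
    (u₀ : EuclideanSpace ℝ (Fin D)) :
    Tendsto (fun p : ℝ × EuclideanSpace ℝ (Fin D) => smear (heatKernel p.1) Q p.2)
      (𝓝[>] 0 ×ˢ 𝓝 u₀) (𝓝 (Q u₀)) := by
  have h1 : Q u₀ = ∫ z : EuclideanSpace ℝ (Fin D), heatKernel 1 z • Q u₀ := by
    rw [integral_smul_const, integral_heatKernel one_pos, one_smul]
  have hev : ∀ᶠ p : ℝ × EuclideanSpace ℝ (Fin D) in 𝓝[>] 0 ×ˢ 𝓝 u₀, 0 < p.1 :=
    tendsto_fst.eventually self_mem_nhdsWithin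
  have hlim : Tendsto (fun p : ℝ × EuclideanSpace ℝ (Fin D) =>
      ∫ z, heatKernel 1 z • Q (p.2 - √p.1 • z)) (𝓝[>] 0 ×ˢ 𝓝 u₀) (𝓝 (Q u₀)) := by
    rw [h1]
    refine tendsto_integral_filter_of_dominated_convergence (fun z => ‖heatKernel 1 z‖ * C)
      (Eventually.of_forall fun p => ?_) (Eventually.of_forall fun p => Eventually.of_forall
        fun z => ?_) ((integrable_heatKernel one_pos).norm.mul_const C)
      (Eventually.of_forall fun z => ?_)
    · have := continuous_heatKernel (D := D) 1
      exact Continuous.aestronglyMeasurable (by fun_prop)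
    · rw [norm_smul]
      exact mul_le_mul_of_nonneg_left (hC _) (norm_nonneg _)
    · have hc : Continuous fun p : ℝ × EuclideanSpace ℝ (Fin D) =>
          heatKernel 1 z • Q (p.2 - √p.1 • z) := by fun_prop
      have h2 := hc.tendsto (0, u₀)
      simp only [Real.sqrt_zero, zero_smul, sub_zero] at h2
      refine h2.mono_left ?_
      rw [nhds_prod_eq]
      exact prod_mono nhdsWithin_le_nhds le_rfl
  refine hlim.congr' ?_
  filter_upwards [hev] with p hp using (smear_heatKernel_eq Q hp p.2).symm

theorem smear_swap (q w : EuclideanSpace ℝ (Fin D) → ℝ) (u : EuclideanSpace ℝ (Fin D)) :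
    smear q w u = smear w q u := by
  rw [smear, smear, ← integral_sub_left_eq_self _ volume u]
  simp [mul_comm]

/-- Here the derivative falls on `Q` instead of on the heat kernel, so it stays controlled as `v →
0`. -/
theorem hasFDerivAt_smear_of_hasCompactSupport {F : Type*} [NormedAddCommGroup F] [NormedSpace ℝ F]
    [SecondCountableTopology F] [SecondCountableTopology (EuclideanSpace ℝ (Fin D) →L[ℝ] F)]
    (hq : Integrable q) {Q : EuclideanSpace ℝ (Fin D) → F} (hQ : ContDiff ℝ 1 Q)
    (hcs : HasCompactSupport Q) (u : EuclideanSpace ℝ (Fin D)) :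
    HasFDerivAt (smear q Q) (smear q (fderiv ℝ Q) u) u := by
  obtain ⟨C₁, hC₁⟩ := hQ.continuous.bounded_above_of_compact_support hcs
  have hd := hQ.continuous_fderiv (by simp)
  obtain ⟨C₂, hC₂⟩ := hd.bounded_above_of_compact_support (hcs.fderiv ℝ)
  exact hasFDerivAt_integral_smul (μ := volume) hq (p := u) (φ := fun y z => Q (y - z))
    (φ' := fun y z => fderiv ℝ Q (y - z)) (U := univ) (C := max C₁ C₂) univ_mem
    (fun y _ => hQ.continuous.comp (continuous_sub_left y)) (hd.comp (continuous_sub_left u))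
    (fun z => (hC₁ _).trans (le_max_left _ _)) (fun y _ z => (hC₂ _).trans (le_max_right _ _))
    (fun y _ z => by
      have h1 : HasFDerivAt (fun y : EuclideanSpace ℝ (Fin D) => y - z)
        (ContinuousLinearMap.id ℝ (EuclideanSpace ℝ (Fin D))) y := (hasFDerivAt_id y).sub_const z
      exact HasFDerivAt.comp y ((hQ.differentiable (by simp)).differentiableAt.hasFDerivAt) h1)

theorem hasCompactSupport_gradient {Q : EuclideanSpace ℝ (Fin D) → ℝ} (hcs : HasCompactSupport Q) :
    HasCompactSupport (gradient Q) := by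
  refine (hcs.fderiv ℝ).comp_left (g := (InnerProductSpace.toDual ℝ _).symm) (map_zero _)

theorem contDiff_gradient {Q : EuclideanSpace ℝ (Fin D) → ℝ} {n m : ℕ} (hQ : ContDiff ℝ n Q)
    (hmn : m + 1 ≤ n) : ContDiff ℝ m (gradient Q) :=
  contDiff_iff_contDiffAt.2 fun _ => hQ.contDiffAt.gradient hmn

theorem hasGradientAt_smear_of_hasCompactSupport
    (hq : Integrable q) {Q : EuclideanSpace ℝ (Fin D) → ℝ} (hQ : ContDiff ℝ 1 Q)
    (hcs : HasCompactSupport Q) (u : EuclideanSpace ℝ (Fin D)) :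
    HasGradientAt (smear q Q) (smear q (gradient Q) u) u := by
  obtain ⟨C, hC⟩ := (contDiff_gradient (n := 1) (m := 0) hQ le_rfl).continuous
    |>.bounded_above_of_compact_support (hasCompactSupport_gradient hcs)
  have h := hasFDerivAt_smear_of_hasCompactSupport hq hQ hcs u
  rw [hasGradientAt_iff_hasFDerivAt]
  refine h.congr_fderiv ?_
  have h2 := smear_congr_clm hq (contDiff_gradient (n := 1) (m := 0) hQ le_rfl).continuous hC
    (innerSL ℝ) u
  have h3 : (fun x => innerSL ℝ (gradient Q x)) = fderiv ℝ Q := by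
    ext x v
    simp
  rw [h3] at h2
  exact h2

/-! ### Moving derivatives from the kernel to a compactly supported datum. -/

section CompactSupport

variable {Q : EuclideanSpace ℝ (Fin D) → ℝ}

/-- One convolution is differentiated in two ways, on the kernel and on the datum; uniqueness of
derivatives identifies the results. The next orders repeat the argument. -/
theorem smear_heatGrad_eq (hQ : ContDiff ℝ 1 Q) (hcs : HasCompactSupport Q) {v : ℝ} (hv : 0 < v) :
    smear Q (heatGrad v) = smear (heatKernel v) (gradient Q) := by
  funext u
  have h1 := hasGradientAt_smear_heatKernel (hQ.continuous.integrable_of_hasCompactSupport hcs) hv u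
  rw [show smear Q (heatKernel v) = smear (heatKernel v) Q from funext fun x => smear_swap _ _ x]
    at h1
  exact h1.unique (hasGradientAt_smear_of_hasCompactSupport (integrable_heatKernel hv) hQ hcs u)

theorem smear_heatHess_eq (hQ : ContDiff ℝ 2 Q) (hcs : HasCompactSupport Q) {v : ℝ} (hv : 0 < v) :
    smear Q (heatHess v) = smear (heatKernel v) (fderiv ℝ (gradient Q)) := by
  funext u
  have h1 := hasFDerivAt_smear_heatGrad_space
    (hQ.continuous.integrable_of_hasCompactSupport hcs) hv u
  rw [smear_heatGrad_eq (hQ.of_le (by norm_num)) hcs hv] at h1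
  exact h1.unique (hasFDerivAt_smear_of_hasCompactSupport (integrable_heatKernel hv)
    (contDiff_gradient (n := 2) (m := 1) hQ le_rfl) (hasCompactSupport_gradient hcs) u)

theorem contDiff_fderiv_gradient (hQ : ContDiff ℝ 3 Q) :
    ContDiff ℝ 1 (fderiv ℝ (gradient Q)) :=
  (contDiff_gradient (n := 3) (m := 2) hQ le_rfl).fderiv_right (m := 1) (by norm_num)

theorem smear_heatGradLap_eq (hQ : ContDiff ℝ 3 Q) (hcs : HasCompactSupport Q) {v : ℝ}
    (hv : 0 < v) :
    smear Q (heatGradLap v) =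
      smear (heatKernel v) (gradient fun x => traceCLM _ (fderiv ℝ (gradient Q) x)) := by
  funext u
  have h1 := hasGradientAt_traceCLM_smear_heatHess
    (hQ.continuous.integrable_of_hasCompactSupport hcs) hv u
  rw [smear_heatHess_eq (hQ.of_le (by norm_num)) hcs hv] at h1
  have hcs2 := (hasCompactSupport_gradient hcs).fderiv ℝ
  have hH := contDiff_fderiv_gradient hQ
  obtain ⟨C, hC⟩ := hH.continuous.bounded_above_of_compact_support hcs2
  have h2 : (fun x => traceCLM _ (smear (heatKernel v) (fderiv ℝ (gradient Q)) x)) =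
      smear (heatKernel v) (fun x => traceCLM _ (fderiv ℝ (gradient Q) x)) := by
    funext x
    exact (smear_congr_clm (integrable_heatKernel hv) hH.continuous hC _ x).symm
  rw [h2] at h1
  have hT : ContDiff ℝ 1 fun x => traceCLM _ (fderiv ℝ (gradient Q) x) :=
    (traceCLM (EuclideanSpace ℝ (Fin D))).contDiff.comp hH
  have hcsT : HasCompactSupport fun x => traceCLM _ (fderiv ℝ (gradient Q) x) :=
    hcs2.comp_left (map_zero (traceCLM (EuclideanSpace ℝ (Fin D))))
  exact h1.unique (hasGradientAt_smear_of_hasCompactSupport (integrable_heatKernel hv) hT hcsT u)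

end CompactSupport

/-- If the evaluation point is within `r / 2` of `u₀`, every `z` with `q z ≠ 0` is at distance at
least `r / 2` from it, where the majorant tends to zero uniformly. -/
theorem tendsto_smear_of_eq_zero {F : Type*} [NormedAddCommGroup F] [NormedSpace ℝ F]
    (hq : Integrable q) {u₀ : EuclideanSpace ℝ (Fin D)} {r : ℝ} (hr : 0 < r)
    (hq0 : ∀ z ∈ Metric.ball u₀ r, q z = 0) {Ψ : ℝ → EuclideanSpace ℝ (Fin D) → F}
    (hΨ : ∀ v, 0 < v → ∀ x, ‖Ψ v x‖ ≤ heatMajorant v x) :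
    Tendsto (fun p : ℝ × EuclideanSpace ℝ (Fin D) => smear q (Ψ p.1) p.2)
      (𝓝[>] 0 ×ˢ 𝓝 u₀) (𝓝 0) := by
  rw [Metric.tendsto_nhds]
  intro ε hε
  set N := ∫ z, ‖q z‖ with hN
  have hN0 : 0 ≤ N := integral_nonneg fun z => norm_nonneg _
  have hδ : 0 < ε / (N + 1) := by positivity
  have h1 := (tendsto_fst (f := 𝓝[>] (0 : ℝ)) (g := 𝓝 u₀)).eventually
    (eventually_heatMajorant_le (D := D) (half_pos hr) hδ)
  have h2 := (tendsto_snd (f := 𝓝[>] (0 : ℝ)) (g := 𝓝 u₀)).eventually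
    (Metric.ball_mem_nhds u₀ (half_pos hr))
  have h3 := (tendsto_fst (f := 𝓝[>] (0 : ℝ)) (g := 𝓝 u₀)).eventually self_mem_nhdsWithin
  filter_upwards [h1, h2, h3] with p hp1 hp2 hp3
  rw [dist_zero_right]
  have hb : ∀ z, ‖q z • Ψ p.1 (p.2 - z)‖ ≤ ‖q z‖ * (ε / (N + 1)) := by
    intro z
    rw [norm_smul]
    by_cases hz : z ∈ Metric.ball u₀ r
    · simp [hq0 z hz]
    · refine mul_le_mul_of_nonneg_left ((hΨ _ hp3 _).trans (hp1 _ ?_)) (norm_nonneg _)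
      rw [Metric.mem_ball, not_lt] at hz
      have := dist_triangle z p.2 u₀
      rw [dist_comm z p.2, dist_eq_norm p.2 z] at this
      linarith
  calc ‖smear q (Ψ p.1) p.2‖ ≤ ∫ z, ‖q z‖ * (ε / (N + 1)) :=
        norm_integral_le_of_norm_le (hq.norm.mul_const _) (Eventually.of_forall hb)
    _ = N * (ε / (N + 1)) := by rw [integral_mul_const]
    _ < ε := by
      rw [mul_div_assoc', div_lt_iff₀ (by positivity)]
      nlinarith

theorem smear_add {F : Type*} [NormedAddCommGroup F] [NormedSpace ℝ F]
    [SecondCountableTopology F] {q₁ q₂ : EuclideanSpace ℝ (Fin D) → ℝ} (h₁ : Integrable q₁)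
    (h₂ : Integrable q₂) {Ψ : EuclideanSpace ℝ (Fin D) → F} (hΨ : Continuous Ψ) {C : ℝ}
    (hC : ∀ x, ‖Ψ x‖ ≤ C) (u : EuclideanSpace ℝ (Fin D)) :
    smear (fun z => q₁ z + q₂ z) Ψ u = smear q₁ Ψ u + smear q₂ Ψ u := by
  rw [smear, smear, smear, ← integral_add
    (integrable_smul_of_bounded h₁ (φ := fun z => Ψ (u - z)) (by fun_prop) (fun z => hC _))
    (integrable_smul_of_bounded h₂ (φ := fun z => Ψ (u - z)) (by fun_prop) (fun z => hC _))]
  simp only [add_smul]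

/-- Splitting off a compactly supported part near `u₀`: the convolutions of `q` with a kernel
dominated by `heatMajorant` converge as soon as those of the compactly supported part do. -/
theorem tendsto_smear_of_local {F : Type*} [NormedAddCommGroup F] [NormedSpace ℝ F]
    [SecondCountableTopology F] [CompleteSpace F] {q₁ q₂ : EuclideanSpace ℝ (Fin D) → ℝ}
    (h₁ : Integrable q₁) (h₂ : Integrable q₂) {u₀ : EuclideanSpace ℝ (Fin D)} {r : ℝ} (hr : 0 < r)
    (hq0 : ∀ z ∈ Metric.ball u₀ r, q₂ z = 0) {Ψ : ℝ → EuclideanSpace ℝ (Fin D) → F}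
    (hc : ∀ v, Continuous (Ψ v))
    (hΨ : ∀ v, 0 < v → ∀ x, ‖Ψ v x‖ ≤ heatMajorant v x)
    {Q : EuclideanSpace ℝ (Fin D) → F} (hQ : Continuous Q) (hcs : HasCompactSupport Q)
    (heq : ∀ v, 0 < v → smear q₁ (Ψ v) = smear (heatKernel v) Q) :
    Tendsto (fun p : ℝ × EuclideanSpace ℝ (Fin D) => smear (fun z => q₁ z + q₂ z) (Ψ p.1) p.2)
      (𝓝[>] 0 ×ˢ 𝓝 u₀) (𝓝 (Q u₀)) := by
  obtain ⟨C, hC⟩ := hQ.bounded_above_of_compact_support hcs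
  have hlim := (tendsto_smear_heatKernel hQ hC u₀).add (tendsto_smear_of_eq_zero h₂ hr hq0 hΨ)
  rw [add_zero] at hlim
  refine hlim.congr' ?_
  filter_upwards [(tendsto_fst (f := 𝓝[>] (0 : ℝ)) (g := 𝓝 u₀)).eventually self_mem_nhdsWithin]
    with p hp
  have hp : 0 < p.1 := hp
  obtain ⟨B, -, hB⟩ := exists_bound_near (D := D) hp
  rw [smear_add h₁ h₂ (hc p.1)
    (fun x => (hΨ _ hp x).trans (hB p.1 ⟨by linarith, by linarith⟩ x)), heq _ hp]

variable {p₀ : EuclideanSpace ℝ (Fin D) → ℝ}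

/-- The heat flow of a `C³` integrable function converges to it locally, together with its
derivatives. -/
theorem tendsto_heatFlow (hp : ContDiff ℝ 3 p₀) (hint : Integrable p₀)
    (u₀ : EuclideanSpace ℝ (Fin D)) :
    Tendsto (fun p : ℝ × EuclideanSpace ℝ (Fin D) => smear p₀ (heatKernel p.1) p.2)
      (𝓝[>] 0 ×ˢ 𝓝 u₀) (𝓝 (p₀ u₀)) ∧
    Tendsto (fun p : ℝ × EuclideanSpace ℝ (Fin D) => smear p₀ (heatGrad p.1) p.2)
      (𝓝[>] 0 ×ˢ 𝓝 u₀) (𝓝 (gradient p₀ u₀)) ∧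
    Tendsto (fun p : ℝ × EuclideanSpace ℝ (Fin D) => smear p₀ (heatHess p.1) p.2)
      (𝓝[>] 0 ×ˢ 𝓝 u₀) (𝓝 (fderiv ℝ (gradient p₀) u₀)) ∧
    Tendsto (fun p : ℝ × EuclideanSpace ℝ (Fin D) => smear p₀ (heatGradLap p.1) p.2)
      (𝓝[>] 0 ×ˢ 𝓝 u₀) (𝓝 (gradient (Laplacian.laplacian p₀) u₀)) := by
  -- The bump equals 1 on the unit ball, so `q₂` vanishes there and `q₁` has the same derivatives as
  -- `p₀` at `u₀`.
  let χ : ContDiffBump u₀ := ⟨1, 2, one_pos, one_lt_two⟩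
  set q₁ : EuclideanSpace ℝ (Fin D) → ℝ := fun z => χ z * p₀ z with hq₁
  set q₂ : EuclideanSpace ℝ (Fin D) → ℝ := fun z => p₀ z - χ z * p₀ z with hq₂
  have hsum : p₀ = fun z => q₁ z + q₂ z := by
    funext z
    simp [hq₁, hq₂]
  have hc₁ : ContDiff ℝ 3 q₁ := χ.contDiff.mul hp
  have hcs : HasCompactSupport q₁ := χ.hasCompactSupport.mul_right
  have hi₁ : Integrable q₁ := hc₁.continuous.integrable_of_hasCompactSupport hcs
  have hi₂ : Integrable q₂ := hint.sub hi₁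
  have hone : ∀ z ∈ Metric.ball u₀ 1, χ z = 1 := fun z hz =>
    χ.one_of_mem_closedBall (Metric.ball_subset_closedBall hz)
  have hz₂ : ∀ z ∈ Metric.ball u₀ 1, q₂ z = 0 := fun z hz => by simp [hq₂, hone z hz]
  have hev : q₁ =ᶠ[𝓝 u₀] p₀ := by
    filter_upwards [Metric.ball_mem_nhds u₀ one_pos] with z hz
    simp [hq₁, hone z hz]
  have hH := contDiff_fderiv_gradient hc₁
  have hcsG := hasCompactSupport_gradient hcs
  have hcsH := hcsG.fderiv ℝ
  have hcsT : HasCompactSupport fun x => traceCLM _ (fderiv ℝ (gradient q₁) x) :=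
    hcsH.comp_left (map_zero (traceCLM (EuclideanSpace ℝ (Fin D))))
  have hT : ContDiff ℝ 1 fun x => traceCLM _ (fderiv ℝ (gradient q₁) x) :=
    (traceCLM (EuclideanSpace ℝ (Fin D))).contDiff.comp hH
  have e1 : gradient q₁ =ᶠ[𝓝 u₀] gradient p₀ := hev.gradient
  have e2 : (fun x => traceCLM _ (fderiv ℝ (gradient q₁) x)) =ᶠ[𝓝 u₀] Laplacian.laplacian p₀ := by
    filter_upwards [e1.fderiv (𝕜 := ℝ)] with x hx
    rw [hx, laplacian_eq_traceCLM (hp.contDiffAt.of_le (by norm_num))]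
  have h1 := tendsto_smear_of_local hi₁ hi₂ one_pos hz₂ (fun v => continuous_heatKernel v)
    (fun v hv => norm_heatKernel_le hv) hc₁.continuous hcs
    (fun v hv => funext fun x => smear_swap _ _ x)
  have h2 := tendsto_smear_of_local hi₁ hi₂ one_pos hz₂ (fun v => continuous_heatGrad v)
    (fun v hv => norm_heatGrad_le hv) (contDiff_gradient (n := 3) (m := 2) hc₁ le_rfl).continuous
    hcsG (fun v hv => smear_heatGrad_eq (hc₁.of_le (by norm_num)) hcs hv)
  have h3 := tendsto_smear_of_local hi₁ hi₂ one_pos hz₂ (fun v => continuous_heatHess v)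
    (fun v hv => norm_heatHess_le hv) hH.continuous hcsH
    (fun v hv => smear_heatHess_eq (hc₁.of_le (by norm_num)) hcs hv)
  have h4 := tendsto_smear_of_local hi₁ hi₂ one_pos hz₂ (fun v => continuous_heatGradLap v)
    (fun v hv => norm_heatGradLap_le hv)
    (contDiff_gradient (n := 1) (m := 0) hT le_rfl).continuous
    (hasCompactSupport_gradient hcsT) (fun v hv => smear_heatGradLap_eq hc₁ hcs hv)
  rw [← hsum] at h1 h2 h3 h4
  rw [hev.eq_of_nhds] at h1
  rw [e1.eq_of_nhds] at h2
  rw [e1.fderiv_eq] at h3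
  rw [e2.gradient_eq] at h4
  exact ⟨h1, h2, h3, h4⟩

end HeatLimit

/-! ### The heat flow from time zero on, and the differentiated critical-point equation. -/

section HeatFlow

variable {D : ℕ} {p₀ : EuclideanSpace ℝ (Fin D) → ℝ}

/-- The heat flow at time `v ≥ 0` of the initial datum `p₀`. -/
noncomputable def heatFlow (p₀ : EuclideanSpace ℝ (Fin D) → ℝ) (v : ℝ) :
    EuclideanSpace ℝ (Fin D) → ℝ :=
  if v = 0 then p₀ else smear p₀ (heatKernel v)

theorem heatFlow_zero : heatFlow p₀ 0 = p₀ := if_pos rfl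

theorem heatFlow_of_pos {v : ℝ} (hv : 0 < v) : heatFlow p₀ v = smear p₀ (heatKernel v) :=
  if_neg hv.ne'

theorem continuous_smear {F : Type*} [NormedAddCommGroup F] [NormedSpace ℝ F]
    [SecondCountableTopology F] {q : EuclideanSpace ℝ (Fin D) → ℝ} (hq : Integrable q)
    {Ψ : EuclideanSpace ℝ (Fin D) → F} (hΨ : Continuous Ψ) {C : ℝ} (hC : ∀ x, ‖Ψ x‖ ≤ C) :
    Continuous (smear q Ψ) := by
  refine continuous_of_dominated (bound := fun z => ‖q z‖ * C)
    (fun u => (integrable_smul_of_bounded hq (φ := fun z => Ψ (u - z)) (by fun_prop)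
      (fun z => hC _)).aestronglyMeasurable) (fun u => Eventually.of_forall fun z => ?_)
    (hq.norm.mul_const C) (Eventually.of_forall fun z => by fun_prop)
  rw [norm_smul]
  exact mul_le_mul_of_nonneg_left (hC _) (norm_nonneg _)

theorem gradient_heatFlow (hint : Integrable p₀) {v : ℝ} (hv : 0 < v) :
    gradient (heatFlow p₀ v) = smear p₀ (heatGrad v) := by
  rw [heatFlow_of_pos hv]
  exact gradient_eq (hasGradientAt_smear_heatKernel hint hv)

theorem fderiv_gradient_heatFlow (hint : Integrable p₀) {v : ℝ} (hv : 0 < v) :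
    fderiv ℝ (gradient (heatFlow p₀ v)) = smear p₀ (heatHess v) := by
  rw [gradient_heatFlow hint hv]
  funext u
  exact (hasFDerivAt_smear_heatGrad_space hint hv u).fderiv

theorem contDiff_heatFlow (hint : Integrable p₀) {v : ℝ} (hv : 0 < v) :
    ContDiff ℝ 2 (heatFlow p₀ v) := by
  obtain ⟨C, -, hC⟩ := exists_bound_near (D := D) hv
  have h1 : ContDiff ℝ 1 (smear p₀ (heatGrad v)) := by
    rw [contDiff_one_iff_fderiv]
    refine ⟨fun u => (hasFDerivAt_smear_heatGrad_space hint hv u).differentiableAt, ?_⟩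
    rw [← gradient_heatFlow hint hv, fderiv_gradient_heatFlow hint hv]
    exact continuous_smear hint (continuous_heatHess v)
      (fun x => (norm_heatHess_le hv x).trans (hC v ⟨by linarith, by linarith⟩ x))
  rw [heatFlow_of_pos hv, show (2 : WithTop ℕ∞) = 1 + 1 by norm_num, contDiff_succ_iff_fderiv]
  refine ⟨fun u => (hasGradientAt_smear_heatKernel hint hv u).differentiableAt, by simp, ?_⟩
  have h2 : fderiv ℝ (smear p₀ (heatKernel v)) = fun u => innerSL ℝ (smear p₀ (heatGrad v) u) :=
    funext fun u => (hasGradientAt_smear_heatKernel hint hv u).hasFDerivAt.fderiv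
  rw [h2]
  exact (innerSL ℝ).contDiff.comp h1

theorem hasGradientAt_laplacian_heatFlow (hint : Integrable p₀) {v : ℝ} (hv : 0 < v)
    (u : EuclideanSpace ℝ (Fin D)) :
    HasGradientAt (Laplacian.laplacian (heatFlow p₀ v)) (smear p₀ (heatGradLap v) u) u := by
  have h : Laplacian.laplacian (heatFlow p₀ v) = fun x => traceCLM _ (smear p₀ (heatHess v) x) := by
    funext x
    rw [laplacian_eq_traceCLM (contDiff_heatFlow hint hv).contDiffAt,
      fderiv_gradient_heatFlow hint hv]
  rw [h]
  exact hasGradientAt_traceCLM_smear_heatHess hint hv u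

/-- The kernel is strictly positive, so the integrand has the same support as `p₀`, which has
positive measure. -/
theorem heatFlow_pos (hnn : ∀ x, 0 ≤ p₀ x) (hint : Integrable p₀) (hone : ∫ x, p₀ x = 1)
    {v : ℝ} (hv : 0 < v) (u : EuclideanSpace ℝ (Fin D)) : 0 < heatFlow p₀ v u := by
  obtain ⟨C, -, hC⟩ := exists_bound_near (D := D) hv
  rw [heatFlow_of_pos hv, smear]
  have hc := continuous_heatKernel (D := D) v
  have h1 : 0 < ∫ x, p₀ x := by rw [hone]; exact one_pos
  rw [integral_pos_iff_support_of_nonneg hnn hint] at h1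
  rw [integral_pos_iff_support_of_nonneg
    (fun z => smul_nonneg (hnn z) (heatKernel_pos hv _).le)
    (integrable_smul_of_bounded hint (φ := fun z => heatKernel v (u - z)) (by fun_prop)
      (fun z => (norm_heatKernel_le hv _).trans (hC v ⟨by linarith, by linarith⟩ _)))]
  convert h1 using 2
  ext z
  simp [(heatKernel_pos hv (u - z)).ne']

theorem contDiff_heatFlow_of_nonneg (hp : ContDiff ℝ 3 p₀) (hint : Integrable p₀) {v : ℝ}
    (hv : 0 ≤ v) : ContDiff ℝ 2 (heatFlow p₀ v) := by
  rcases hv.eq_or_lt with rfl | hv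
  · rw [heatFlow_zero]
    exact hp.of_le (by norm_num)
  · exact contDiff_heatFlow hint hv

theorem differentiable_laplacian_heatFlow (hp : ContDiff ℝ 3 p₀) (hint : Integrable p₀) {v : ℝ}
    (hv : 0 ≤ v) : Differentiable ℝ (Laplacian.laplacian (heatFlow p₀ v)) := by
  rcases hv.eq_or_lt with rfl | hv
  · rw [heatFlow_zero]
    exact fun x => hp.contDiffAt.differentiableAt_laplacian
  · exact fun x => (hasGradientAt_laplacian_heatFlow hint hv x).differentiableAt

/-- The differentiated first-order condition for a mode `w s` of
`u ↦ exp (-‖u - a‖² / (2 (τ - v s))) * heatFlow p₀ (v s) u`. -/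
theorem heatFlow_mode_equation (hint : Integrable p₀) {v : ℝ → ℝ}
    {w : ℝ → EuclideanSpace ℝ (Fin D)} {s τ v' : ℝ} {a w' : EuclideanSpace ℝ (Fin D)}
    (hv : HasDerivAt v v' s) (hw : HasDerivAt w w' s) (hv0 : 0 < v s) (hvτ : v s < τ)
    (hpos : 0 < heatFlow p₀ (v s) (w s))
    (hcrit : ∀ᶠ r in 𝓝 s, gradient (heatFlow p₀ (v r)) (w r) =
      (heatFlow p₀ (v r) (w r) / (τ - v r)) • (w r - a)) :
    (logHess (heatFlow p₀ (v s) (w s)) (gradient (heatFlow p₀ (v s)) (w s))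
        (fderiv ℝ (gradient (heatFlow p₀ (v s))) (w s)) -
      (τ - v s)⁻¹ • ContinuousLinearMap.id ℝ (EuclideanSpace ℝ (Fin D)))
      (w' + v' • (heatFlow p₀ (v s) (w s))⁻¹ • gradient (heatFlow p₀ (v s)) (w s)) =
    -((1 / 2 * v') • logGradLap (heatFlow p₀ (v s) (w s)) (gradient (heatFlow p₀ (v s)) (w s))
        (fderiv ℝ (gradient (heatFlow p₀ (v s))) (w s))
        (gradient (Laplacian.laplacian (heatFlow p₀ (v s))) (w s))) := by
  have hvpos : ∀ᶠ r in 𝓝 s, 0 < v r := hv.continuousAt.eventually (lt_mem_nhds hv0)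
  rw [fderiv_gradient_heatFlow hint hv0, (hasGradientAt_laplacian_heatFlow hint hv0 _).gradient]
  have hK : HasDerivAt (fun r => smear p₀ (heatKernel (v r)) (w r))
      (v' * ((1 / 2) * traceCLM _ (smear p₀ (heatHess (v s)) (w s))) +
        inner ℝ (smear p₀ (heatGrad (v s)) (w s)) w') s := by
    have h := (hasFDerivAt_smear_heatKernel hint hv0 (w s)).comp_hasDerivAt s (hv.prodMk hw)
    rw [timeSpace_apply] at h
    exact h
  have hG : HasDerivAt (fun r => smear p₀ (heatGrad (v r)) (w r))
      (v' • ((1 / 2 : ℝ) • smear p₀ (heatGradLap (v s)) (w s)) +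
        smear p₀ (heatHess (v s)) (w s) w') s := by
    have h := (hasFDerivAt_smear_heatGrad hint hv0 (w s)).comp_hasDerivAt s (hv.prodMk hw)
    rw [timeSpace_apply] at h
    exact h
  have hd0 : τ - v s ≠ 0 := (sub_pos.2 hvτ).ne'
  have hR := (hK.div (hv.const_sub τ) hd0).smul (hw.sub_const a)
  have hcrit' : (fun r => smear p₀ (heatGrad (v r)) (w r)) =ᶠ[𝓝 s]
      fun r => (smear p₀ (heatKernel (v r)) (w r) / (τ - v r)) • (w r - a) := by
    filter_upwards [hcrit, hvpos] with r hr hvr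
    rw [← gradient_heatFlow hint hvr, hr, heatFlow_of_pos hvr]
  -- Both sides of the critical-point identity are differentiated along the curve.
  have heq := hG.unique (hR.congr_of_eventuallyEq hcrit')
  simp only [Pi.div_apply] at heq
  have hcs := hcrit'.eq_of_nhds
  rw [gradient_heatFlow hint hv0]
  rw [heatFlow_of_pos hv0] at hpos ⊢
  generalize smear p₀ (heatKernel (v s)) (w s) = K at *
  generalize smear p₀ (heatGrad (v s)) (w s) = G at *
  generalize smear p₀ (heatHess (v s)) (w s) = H at *
  generalize smear p₀ (heatGradLap (v s)) (w s) = J at *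
  generalize τ - v s = d at *
  have hK0 := hpos.ne'
  -- The undifferentiated identity eliminates `a`, so the result involves only derivatives of the
  -- density.
  have hwa : w s - a = (d / K) • G := by
    rw [hcs, smul_smul, div_mul_div_cancel₀ hK0, div_self hd0, one_smul]
  rw [hwa] at heq
  -- With `H w'` substituted, the terms in `H G` and in the trace cancel and the rest matches scalar
  -- by scalar.
  have hHw : H w' = (K / d) • w' + (((v' * (1 / 2 * traceCLM _ H) + inner ℝ G w') * d - K * -v') /
      d ^ 2) • (d / K) • G - v' • (1 / 2 : ℝ) • J := by
    rw [eq_sub_iff_add_eq, add_comm, heq]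
  simp only [logGradLap, logHess, _root_.sub_apply, _root_.smul_apply,
    ContinuousLinearMap.smulRight_apply, innerSL_apply_apply, map_add, map_smul,
    ContinuousLinearMap.id_apply, hHw]
  match_scalars <;> field_simp <;> ring

end HeatFlow

/-! ### Modes of Gaussian tilts of the heat flow, and the endpoints of the curve. -/

section Modes

variable {D : ℕ} {p₀ : EuclideanSpace ℝ (Fin D) → ℝ}

/-- The unnormalised Gaussian tilt `exp (-‖u - a‖² / (2 d)) * k u`. -/
noncomputable def gaussianTilt (a : EuclideanSpace ℝ (Fin D)) (d : ℝ)
    (k : EuclideanSpace ℝ (Fin D) → ℝ) (u : EuclideanSpace ℝ (Fin D)) : ℝ :=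
  Real.exp (-‖u - a‖ ^ 2 / (2 * d)) * k u

/-- Fermat's rule, with the nonvanishing exponential factor cancelled. -/
theorem gradient_eq_of_isMaxOn_gaussianTilt {a w : EuclideanSpace ℝ (Fin D)} {d : ℝ} (hd : d ≠ 0)
    {k : EuclideanSpace ℝ (Fin D) → ℝ} (hk : DifferentiableAt ℝ k w)
    (hmax : IsMaxOn (gaussianTilt a d k) univ w) :
    gradient k w = (k w / d) • (w - a) := by
  have h1 : HasFDerivAt (fun u => -‖u - a‖ ^ 2 * (2 * d)⁻¹)
      (-(d⁻¹ • innerSL ℝ (w - a))) w := by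
    refine ((((hasFDerivAt_id w).sub_const a).norm_sq).neg.mul_const ((2 * d)⁻¹)).congr_fderiv ?_
    ext u
    simp
    field_simp
  have h2 := h1.exp.mul hk.hasGradientAt.hasFDerivAt
  have h3 := (hmax.isLocalMax univ_mem).hasFDerivAt_eq_zero (f := gaussianTilt a d k) h2
  refine ext_inner_right ℝ fun u => ?_
  have h4 := DFunLike.congr_fun h3 u
  have he := Real.exp_pos (-‖w - a‖ ^ 2 * (2 * d)⁻¹)
  simp only [_root_.add_apply, _root_.smul_apply, InnerProductSpace.toDual_apply_apply,
    _root_.neg_apply, innerSL_apply_apply, smul_eq_mul, _root_.zero_apply] at h4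
  rw [inner_smul_left]
  have h5 : rexp (-‖w - a‖ ^ 2 * (2 * d)⁻¹) *
      (inner ℝ (gradient k w) u - k w / d * inner ℝ (w - a) u) = 0 := by
    rw [← h4]
    ring
  have h6 := (mul_eq_zero.1 h5).resolve_left he.ne'
  simpa using sub_eq_zero.1 h6

theorem continuousAt_heatFlow_prod (hint : Integrable p₀) {v : ℝ} (hv : 0 < v)
    (u : EuclideanSpace ℝ (Fin D)) :
    ContinuousAt (fun p : ℝ × EuclideanSpace ℝ (Fin D) => heatFlow p₀ p.1 p.2) (v, u) := by
  refine (hasFDerivAt_smear_heatKernel hint hv u).continuousAt.congr ?_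
  have h : ∀ᶠ p : ℝ × EuclideanSpace ℝ (Fin D) in 𝓝 (v, u), 0 < p.1 :=
    continuousAt_fst.eventually (lt_mem_nhds hv)
  filter_upwards [h] with p hp
  rw [heatFlow_of_pos hp]

theorem tendsto_heatFlow_zero (hp : ContDiff ℝ 3 p₀) (hint : Integrable p₀)
    {v : ℝ → ℝ} {w : ℝ → EuclideanSpace ℝ (Fin D)} {u₀ : EuclideanSpace ℝ (Fin D)}
    (hv : Tendsto v (𝓝[>] 0) (𝓝[>] 0)) (hw : Tendsto w (𝓝[>] 0) (𝓝 u₀)) :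
    Tendsto (fun s => heatFlow p₀ (v s) (w s)) (𝓝[>] 0) (𝓝 (p₀ u₀)) := by
  refine ((tendsto_heatFlow hp hint u₀).1.comp (hv.prodMk hw)).congr' ?_
  filter_upwards [hv.eventually self_mem_nhdsWithin] with s hs
  rw [heatFlow_of_pos hs]
  rfl

/-- For each fixed competitor `x`, both sides of the maximality inequality converge as `s → 0`. -/
theorem isMaxOn_gaussianTilt_zero (hp : ContDiff ℝ 3 p₀) (hint : Integrable p₀)
    {v : ℝ → ℝ} {w : ℝ → EuclideanSpace ℝ (Fin D)} {a u₀ : EuclideanSpace ℝ (Fin D)} {t τ : ℝ}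
    (ht : 0 < t) (hτ : 0 < τ)
    (hv : Tendsto v (𝓝[>] 0) (𝓝[>] 0)) (hw : Tendsto w (𝓝[>] 0) (𝓝 u₀))
    (hmax : ∀ s ∈ Ioo 0 t, IsMaxOn (gaussianTilt a (τ - v s) (heatFlow p₀ (v s))) univ (w s)) :
    IsMaxOn (gaussianTilt a τ p₀) univ u₀ := by
  have hv' : Tendsto v (𝓝[>] 0) (𝓝 0) := hv.mono_right nhdsWithin_le_nhds
  have key : ∀ {z : ℝ → EuclideanSpace ℝ (Fin D)} {x : EuclideanSpace ℝ (Fin D)},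
      Tendsto z (𝓝[>] 0) (𝓝 x) →
      Tendsto (fun s => gaussianTilt a (τ - v s) (heatFlow p₀ (v s)) (z s)) (𝓝[>] 0)
        (𝓝 (gaussianTilt a τ p₀ x)) := by
    intro z x hz
    unfold gaussianTilt
    refine Tendsto.mul ?_ (tendsto_heatFlow_zero hp hint hv hz)
    refine (Real.continuous_exp.tendsto _).comp ?_
    refine Tendsto.div (((hz.sub_const a).norm.pow 2).neg) ?_ (by positivity)
    simpa using (hv'.const_sub τ).const_mul 2
  rw [isMaxOn_iff]
  intro x _
  refine le_of_tendsto_of_tendsto (key tendsto_const_nhds) (key hw) ?_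
  filter_upwards [Ioo_mem_nhdsGT ht] with s hs
  exact isMaxOn_iff.1 (hmax s hs) x (mem_univ x)

/-- Compare with the competitor `a`, where the exponential is 1. If `u₁ ≠ a`, the exponential at `w
s` tends to zero since `τ - v s → 0`, and the limit of the inequality contradicts positivity of the
heat flow at `a`. -/
theorem eq_of_isMaxOn_gaussianTilt (hint : Integrable p₀) (hnn : ∀ x, 0 ≤ p₀ x)
    (hone : ∫ x, p₀ x = 1)
    {v : ℝ → ℝ} {w : ℝ → EuclideanSpace ℝ (Fin D)} {a u₁ : EuclideanSpace ℝ (Fin D)} {t τ : ℝ}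
    (ht : 0 < t) (hτ : 0 < τ)
    (hv : Tendsto v (𝓝[<] t) (𝓝 τ)) (hvτ : ∀ s ∈ Ioo 0 t, v s < τ)
    (hw : Tendsto w (𝓝[<] t) (𝓝 u₁))
    (hmax : ∀ s ∈ Ioo 0 t, IsMaxOn (gaussianTilt a (τ - v s) (heatFlow p₀ (v s))) univ (w s)) :
    u₁ = a := by
  by_contra hne
  have hIoo : ∀ᶠ s in 𝓝[<] t, s ∈ Ioo 0 t := Ioo_mem_nhdsLT ht
  have key : ∀ {z : ℝ → EuclideanSpace ℝ (Fin D)} {x : EuclideanSpace ℝ (Fin D)},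
      Tendsto z (𝓝[<] t) (𝓝 x) →
      Tendsto (fun s => heatFlow p₀ (v s) (z s)) (𝓝[<] t) (𝓝 (heatFlow p₀ τ x)) :=
    fun {z x} hz => (continuousAt_heatFlow_prod hint hτ x).tendsto.comp (hv.prodMk_nhds hz)
  have hd : Tendsto (fun s => (τ - v s)⁻¹) (𝓝[<] t) atTop := by
    refine tendsto_inv_nhdsGT_zero.comp (tendsto_nhdsWithin_iff.2 ⟨?_, ?_⟩)
    · simpa using hv.const_sub τ
    · filter_upwards [hIoo] with s hs using sub_pos.2 (hvτ s hs)
  have hpos : 0 < ‖u₁ - a‖ ^ 2 / 2 := by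
    have := norm_pos_iff.2 (sub_ne_zero.2 hne)
    positivity
  have he : Tendsto (fun s => Real.exp (-‖w s - a‖ ^ 2 / (2 * (τ - v s)))) (𝓝[<] t) (𝓝 0) := by
    have h1 : Tendsto (fun s => ‖w s - a‖ ^ 2 / 2 * (τ - v s)⁻¹) (𝓝[<] t) atTop :=
      Tendsto.pos_mul_atTop hpos (((hw.sub_const a).norm.pow 2).div_const 2) hd
    refine (Real.tendsto_exp_neg_atTop_nhds_zero.comp h1).congr fun s => ?_
    simp only [Function.comp_apply]
    congr 1
    rw [← div_div, neg_div, neg_div, div_eq_mul_inv _ (τ - v s)]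
  have hlim := he.mul (key hw)
  rw [zero_mul] at hlim
  refine absurd (le_of_tendsto_of_tendsto (key (tendsto_const_nhds (x := a))) hlim ?_)
    (not_le.2 (heatFlow_pos hnn hint hone hτ a))
  filter_upwards [hIoo] with s hs
  have := isMaxOn_iff.1 (hmax s hs) a (mem_univ a)
  simpa [gaussianTilt] using this

/-- Needed at `s = 0`: `p₀` may vanish somewhere, but not at a mode, so `log p₀` is smooth there. -/
theorem pos_of_isMaxOn_gaussianTilt {k : EuclideanSpace ℝ (Fin D) → ℝ} (hnn : ∀ x, 0 ≤ k x)
    (hk : ∃ x, k x ≠ 0) {a w : EuclideanSpace ℝ (Fin D)} {d : ℝ}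
    (hmax : IsMaxOn (gaussianTilt a d k) univ w) : 0 < k w := by
  obtain ⟨x, hx⟩ := hk
  have h1 := isMaxOn_iff.1 hmax x (mem_univ x)
  have h2 : 0 < gaussianTilt a d k x :=
    mul_pos (Real.exp_pos _) ((hnn x).lt_of_ne' hx)
  exact pos_of_mul_pos_right (h2.trans_le h1) (Real.exp_pos _).le

/-- The defect of the mode-tracking equation as a function of the value `c`, gradient `G`,
Hessian `H` and gradient of the Laplacian `J` of the density, of `d⁻¹`, and of the velocities. -/
noncomputable def modeDefect (p : ℝ × EuclideanSpace ℝ (Fin D) ×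
    (EuclideanSpace ℝ (Fin D) →L[ℝ] EuclideanSpace ℝ (Fin D)) × EuclideanSpace ℝ (Fin D) × ℝ ×
    EuclideanSpace ℝ (Fin D) × ℝ) : EuclideanSpace ℝ (Fin D) :=
  (logHess p.1 p.2.1 p.2.2.1 - p.2.2.2.2.1⁻¹ • ContinuousLinearMap.id ℝ (EuclideanSpace ℝ (Fin D)))
    (p.2.2.2.2.2.1 + p.2.2.2.2.2.2 • p.1⁻¹ • p.2.1) +
  (1 / 2 * p.2.2.2.2.2.2) • logGradLap p.1 p.2.1 p.2.2.1 p.2.2.2.1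

theorem _root_.ContinuousAt.logHess {X : Type*} [TopologicalSpace X] {x : X} {c : X → ℝ}
    {G : X → EuclideanSpace ℝ (Fin D)}
    {H : X → EuclideanSpace ℝ (Fin D) →L[ℝ] EuclideanSpace ℝ (Fin D)} (hc : ContinuousAt c x)
    (hG : ContinuousAt G x) (hH : ContinuousAt H x) (h0 : c x ≠ 0) :
    ContinuousAt (fun y => logHess (c y) (G y) (H y)) x := by
  have h : Continuous fun g : EuclideanSpace ℝ (Fin D) => (innerSL ℝ g).smulRight g := by fun_prop
  exact ((hc.inv₀ h0).smul hH).sub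
    (((hc.pow 2).inv₀ (pow_ne_zero 2 h0)).smul (h.continuousAt.comp hG))

/-- This carries the equation from `s > 0` to `s = 0`. -/
theorem continuousAt_modeDefect (p : ℝ × EuclideanSpace ℝ (Fin D) ×
    (EuclideanSpace ℝ (Fin D) →L[ℝ] EuclideanSpace ℝ (Fin D)) × EuclideanSpace ℝ (Fin D) × ℝ ×
    EuclideanSpace ℝ (Fin D) × ℝ) (hc : p.1 ≠ 0) (hd : p.2.2.2.2.1 ≠ 0) :
    ContinuousAt modeDefect p := by
  have c0 : ContinuousAt (Prod.fst : ℝ × EuclideanSpace ℝ (Fin D) ×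
    (EuclideanSpace ℝ (Fin D) →L[ℝ] EuclideanSpace ℝ (Fin D)) × EuclideanSpace ℝ (Fin D) × ℝ ×
    EuclideanSpace ℝ (Fin D) × ℝ → ℝ) p := continuousAt_fst
  have c1 := continuousAt_snd (p := p)
  have cG := c1.fst
  have cH := c1.snd.fst
  have cJ := c1.snd.snd.fst
  have cd := c1.snd.snd.snd.fst
  have cw := c1.snd.snd.snd.snd.fst
  have cv := c1.snd.snd.snd.snd.snd
  have hL := c0.logHess cG cH hc
  have hi := c0.inv₀ hc
  refine ((hL.sub ((cd.inv₀ hd).smul continuousAt_const)).clm_apply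
    (cw.add (cv.smul (hi.smul cG)))).add ((continuousAt_const.mul cv).smul ?_)
  exact ((hi.smul cJ).sub ((((c0.pow 2).inv₀ (pow_ne_zero 2 hc)).mul
    ((traceCLM _).continuous.continuousAt.comp cH)).smul cG)).sub
      ((hL.clm_apply (hi.smul cG)).const_smul (2 : ℝ))

/-- The mode-tracking equation along the heat flow, including the initial time. -/
theorem heatFlow_mode_tracking (hp : ContDiff ℝ 3 p₀) (hnn : ∀ x, 0 ≤ p₀ x)
    (hint : Integrable p₀) (hone : ∫ x, p₀ x = 1)
    {v v' : ℝ → ℝ} {w w' : ℝ → EuclideanSpace ℝ (Fin D)} {a : EuclideanSpace ℝ (Fin D)} {t τ : ℝ}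
    (ht : 0 < t) (hv0 : v 0 = 0) (hvlim : Tendsto v (𝓝[>] 0) (𝓝 0))
    (hvpos : ∀ s ∈ Ioo 0 t, 0 < v s) (hvτ : ∀ s ∈ Ico 0 t, v s < τ)
    (hv : ∀ s ∈ Ioo 0 t, HasDerivAt v (v' s) s) (hv' : Tendsto v' (𝓝[>] 0) (𝓝 (v' 0)))
    (hwlim : Tendsto w (𝓝[>] 0) (𝓝 (w 0)))
    (hw : ∀ s ∈ Ioo 0 t, HasDerivAt w (w' s) s) (hw' : Tendsto w' (𝓝[>] 0) (𝓝 (w' 0)))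
    (hmax : ∀ s ∈ Ioo 0 t, IsMaxOn (gaussianTilt a (τ - v s) (heatFlow p₀ (v s))) univ (w s)) :
    ∀ s ∈ Ico 0 t, 0 < heatFlow p₀ (v s) (w s) ∧
      (fderiv ℝ (gradient fun u => Real.log (heatFlow p₀ (v s) u)) (w s) -
        (τ - v s)⁻¹ • ContinuousLinearMap.id ℝ (EuclideanSpace ℝ (Fin D)))
        (w' s + v' s • gradient (fun u => Real.log (heatFlow p₀ (v s) u)) (w s)) =
      -((1 / 2 * v' s) •
        gradient (Laplacian.laplacian fun u => Real.log (heatFlow p₀ (v s) u)) (w s)) := by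
  have hτ : 0 < τ := hv0 ▸ hvτ 0 ⟨le_rfl, ht⟩
  have hIoo : ∀ᶠ s in 𝓝[>] (0 : ℝ), s ∈ Ioo 0 t := Ioo_mem_nhdsGT ht
  have hvlim' : Tendsto v (𝓝[>] 0) (𝓝[>] 0) := by
    refine tendsto_nhdsWithin_iff.2 ⟨hvlim, ?_⟩
    filter_upwards [hIoo] with s hs using hvpos s hs
  have hvnn : ∀ s ∈ Ico 0 t, 0 ≤ v s := by
    intro s hs
    rcases hs.1.eq_or_lt with rfl | h0
    · exact hv0.ge
    · exact (hvpos s ⟨h0, hs.2⟩).le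
  have hne : ∃ x, p₀ x ≠ 0 := by
    by_contra! h
    simp [h] at hone
  have hpos : ∀ s ∈ Ico 0 t, 0 < heatFlow p₀ (v s) (w s) := by
    intro s hs
    rcases hs.1.eq_or_lt with rfl | h0
    · rw [hv0, heatFlow_zero]
      exact pos_of_isMaxOn_gaussianTilt hnn hne
        (isMaxOn_gaussianTilt_zero hp hint ht hτ hvlim' hwlim hmax)
    · exact heatFlow_pos hnn hint hone (hvpos s ⟨h0, hs.2⟩) _
  have hdefect : ∀ s ∈ Ioo 0 t, modeDefect (heatFlow p₀ (v s) (w s),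
      gradient (heatFlow p₀ (v s)) (w s), fderiv ℝ (gradient (heatFlow p₀ (v s))) (w s),
      gradient (Laplacian.laplacian (heatFlow p₀ (v s))) (w s), τ - v s, w' s, v' s) = 0 := by
    intro s hs
    have h := heatFlow_mode_equation hint (hv s hs) (hw s hs) (hvpos s hs)
      (hvτ s ⟨hs.1.le, hs.2⟩) (hpos s ⟨hs.1.le, hs.2⟩) (a := a) (by
        filter_upwards [Ioo_mem_nhds hs.1 hs.2] with r hr
        exact gradient_eq_of_isMaxOn_gaussianTilt (sub_pos.2 (hvτ r ⟨hr.1.le, hr.2⟩)).ne'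
          ((contDiff_heatFlow hint (hvpos r hr)).differentiable (by simp) _) (hmax r hr))
    simp only [modeDefect]
    rw [h, neg_add_cancel]
  -- At `s = 0` nothing is differentiated in time: all arguments of `modeDefect` converge as `s → 0`
  -- from the right, and the defect vanishes along the way.
  have hdefect0 : modeDefect (heatFlow p₀ (v 0) (w 0),
      gradient (heatFlow p₀ (v 0)) (w 0), fderiv ℝ (gradient (heatFlow p₀ (v 0))) (w 0),
      gradient (Laplacian.laplacian (heatFlow p₀ (v 0))) (w 0), τ - v 0, w' 0, v' 0) = 0 := by
    obtain ⟨h1, h2, h3, h4⟩ := tendsto_heatFlow hp hint (w 0)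
    have hpw := hvlim'.prodMk hwlim
    have hlim := (h1.comp hpw).prodMk_nhds ((h2.comp hpw).prodMk_nhds ((h3.comp hpw).prodMk_nhds
      ((h4.comp hpw).prodMk_nhds ((hvlim.const_sub τ).prodMk_nhds (hw'.prodMk_nhds hv')))))
    have hp0 := hpos 0 ⟨le_rfl, ht⟩
    rw [hv0, heatFlow_zero] at hp0 ⊢
    have hlim2 := (continuousAt_modeDefect _ hp0.ne' (by simpa using hτ.ne')).tendsto.comp hlim
    refine tendsto_nhds_unique hlim2 (tendsto_const_nhds.congr' ?_)
    filter_upwards [hIoo] with s hs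
    have h := hdefect s hs
    rw [fderiv_gradient_heatFlow hint (hvpos s hs), gradient_heatFlow hint (hvpos s hs),
      (hasGradientAt_laplacian_heatFlow hint (hvpos s hs) _).gradient,
      heatFlow_of_pos (hvpos s hs)] at h
    exact h.symm
  intro s hs
  refine ⟨hpos s hs, ?_⟩
  have hC := (contDiff_heatFlow_of_nonneg hp hint (hvnn s hs)).contDiffAt (x := w s)
  have hL := differentiable_laplacian_heatFlow hp hint (hvnn s hs) (w s)
  rw [(hasFDerivAt_gradient_log hC (hpos s hs)).fderiv,
    (hasGradientAt_log (hC.differentiableAt (by simp)) (hpos s hs)).gradient,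
    (hasGradientAt_laplacian_log hC hL (hpos s hs)).gradient, ← add_eq_zero_iff_eq_neg]
  rcases hs.1.eq_or_lt with rfl | h0
  · exact hdefect0
  · exact hdefect s ⟨h0, hs.2⟩

end Modes

/-! ### Reduction of the noise schedule to the heat flow. -/

namespace NoiseSchedule

variable {T : ℝ} (S : NoiseSchedule T)

/-- The variance of `p_{s|0}` in units of the squared signal level. -/
noncomputable def scaledVar (s : ℝ) : ℝ := S.transVar 0 s / S.transMean 0 s ^ 2

variable {S}

theorem zero_mem_Icc_of_mem {s : ℝ} (hs : s ∈ Icc 0 T) : (0 : ℝ) ∈ Icc 0 T :=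
  ⟨le_rfl, hs.1.trans hs.2⟩

theorem transMean_pos {s t : ℝ} (hs : s ∈ Icc 0 T) (ht : t ∈ Icc 0 T) : 0 < S.transMean s t :=
  div_pos (S.α_pos t ht) (S.α_pos s hs)

theorem transMean_zero_zero (hT : 0 ≤ T) : S.transMean 0 0 = 1 :=
  div_self (S.α_pos 0 ⟨le_rfl, hT⟩).ne'

/-- A multiple of the increase of the noise-to-signal ratio since time 0; this shows monotonicity
and covers `σ 0 > 0` as well. -/
theorem scaledVar_eq {s : ℝ} (hs : s ∈ Icc 0 T) :
    S.scaledVar s = S.α 0 ^ 2 * (S.σ s ^ 2 / S.α s ^ 2 - S.σ 0 ^ 2 / S.α 0 ^ 2) := by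
  have h0 := S.α_pos 0 (zero_mem_Icc_of_mem hs)
  have h1 := S.α_pos s hs
  unfold scaledVar transVar transMean
  field_simp

theorem scaledVar_zero (hT : 0 ≤ T) : S.scaledVar 0 = 0 := by
  rw [scaledVar_eq ⟨le_rfl, hT⟩, sub_self, mul_zero]

theorem scaledVar_lt {s t : ℝ} (hs : s ∈ Icc 0 T) (ht : t ∈ Icc 0 T) (hst : s < t) :
    S.scaledVar s < S.scaledVar t := by
  have h0 := S.α_pos 0 (zero_mem_Icc_of_mem hs)
  have h1 : S.σ s ^ 2 / S.α s ^ 2 < S.σ t ^ 2 / S.α t ^ 2 := S.snr_decreasing hs ht hst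
  rw [scaledVar_eq hs, scaledVar_eq ht]
  gcongr

/-- Variances add in the rescaled coordinates: the step from `s` to `t` contributes `v t - v s`. -/
theorem transVar_eq {s t : ℝ} (hs : s ∈ Icc 0 T) (ht : t ∈ Icc 0 T) :
    S.transVar s t = S.transMean 0 t ^ 2 * (S.scaledVar t - S.scaledVar s) := by
  have h0 := S.α_pos 0 (zero_mem_Icc_of_mem hs)
  have h1 := S.α_pos s hs
  have h2 := S.α_pos t ht
  rw [scaledVar_eq hs, scaledVar_eq ht]
  unfold transVar transMean
  field_simp
  ring

theorem transMean_eq_div {s t : ℝ} (hs : s ∈ Icc 0 T) :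
    S.transMean s t = S.transMean 0 t / S.transMean 0 s := by
  have h0 := S.α_pos 0 (zero_mem_Icc_of_mem hs)
  have h1 := S.α_pos s hs
  unfold transMean
  field_simp

theorem psi_eq_inv {s t : ℝ} (hs : s ∈ Icc 0 T) (ht : t ∈ Icc 0 T) :
    S.psi t s = (S.transMean 0 s)⁻¹ ^ 2 * (S.scaledVar t - S.scaledVar s)⁻¹ := by
  have h1 := transMean_pos (S := S) (zero_mem_Icc_of_mem hs) hs
  have h2 := transMean_pos (S := S) (zero_mem_Icc_of_mem hs) ht
  rw [psi, transVar_eq hs ht, transMean_eq_div hs, div_pow, inv_pow, mul_comm (_ ^ 2)⁻¹,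
    div_eq_mul_inv, mul_inv]
  field_simp

theorem hasDerivWithinAt_α {s : ℝ} (hs : s ∈ Icc 0 T) :
    HasDerivWithinAt S.α (S.f s * S.α s) (Icc 0 T) s := by
  have h := (S.f_eq s hs).exp
  refine (h.congr (fun u hu => (Real.exp_log (S.α_pos u hu)).symm)
    (Real.exp_log (S.α_pos s hs)).symm).congr_deriv ?_
  rw [Real.exp_log (S.α_pos s hs), mul_comm]

theorem continuousOn_α : ContinuousOn S.α (Icc 0 T) :=
  fun _ hs => (hasDerivWithinAt_α hs).continuousWithinAt

theorem continuousOn_transMean : ContinuousOn (S.transMean 0) (Icc 0 T) :=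
  continuousOn_α.div_const _

theorem hasDerivAt_transMean {s : ℝ} (hs : s ∈ Ioo 0 T) :
    HasDerivAt (S.transMean 0) (S.f s * S.transMean 0 s) s := by
  have h := ((hasDerivWithinAt_α (S := S) ⟨hs.1.le, hs.2.le⟩).hasDerivAt
    (Icc_mem_nhds hs.1 hs.2)).div_const (S.α 0)
  rw [mul_div_assoc] at h
  exact h

theorem continuousOn_scaledVar : ContinuousOn S.scaledVar (Icc 0 T) := by
  have h : ContinuousOn (fun s => S.α 0 ^ 2 * (S.σ s ^ 2 / S.α s ^ 2 - S.σ 0 ^ 2 / S.α 0 ^ 2))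
      (Icc 0 T) :=
    (((S.σ_cont.pow 2).div (continuousOn_α.pow 2)
      fun s hs => (pow_pos (S.α_pos s hs) 2).ne').sub continuousOn_const).const_mul _
  exact h.congr fun s hs => scaledVar_eq hs

/-- Up to a constant, `v` is `α₀² e^{-λ}`, whose derivative is `-λ' α₀² σ² / α² = g² / m²`. -/
theorem hasDerivAt_scaledVar {s : ℝ} (hs : s ∈ Ioo 0 T) :
    HasDerivAt S.scaledVar (S.g s ^ 2 / S.transMean 0 s ^ 2) s := by
  obtain ⟨l', hl', hg⟩ := S.g_eq s ⟨hs.1, hs.2.le⟩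
  have h0 := S.α_pos 0 ⟨le_rfl, hs.1.le.trans hs.2.le⟩
  have h1 := S.α_pos s ⟨hs.1.le, hs.2.le⟩
  have h2 := S.σ_pos s ⟨hs.1, hs.2.le⟩
  have hexp : ∀ u ∈ Ioo 0 T,
      Real.exp (-Real.log (S.α u ^ 2 / S.σ u ^ 2)) = S.σ u ^ 2 / S.α u ^ 2 := by
    intro u hu
    have h1 := S.α_pos u ⟨hu.1.le, hu.2.le⟩
    have h2 := S.σ_pos u ⟨hu.1, hu.2.le⟩
    rw [Real.exp_neg, Real.exp_log (by positivity), inv_div]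
  have h3 := (((hl'.hasDerivAt (Icc_mem_nhds hs.1 hs.2)).neg.exp).sub_const
    (S.σ 0 ^ 2 / S.α 0 ^ 2)).const_mul (S.α 0 ^ 2)
  refine (h3.congr_of_eventuallyEq ?_).congr_deriv ?_
  · filter_upwards [Ioo_mem_nhds hs.1 hs.2] with u hu
    rw [scaledVar_eq ⟨hu.1.le, hu.2.le⟩, ← hexp u hu]
    rfl
  · simp only [Pi.neg_apply]
    rw [hexp s hs, hg, transMean]
    field_simp

variable {D : ℕ} {p₀ : EuclideanSpace ℝ (Fin D) → ℝ}

theorem marginal_eq {s : ℝ} (hs : s ∈ Icc 0 T) (x : EuclideanSpace ℝ (Fin D)) :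
    S.marginal p₀ s x = (S.transMean 0 s ^ D)⁻¹ *
      heatFlow p₀ (S.scaledVar s) ((S.transMean 0 s)⁻¹ • x) := by
  have hT : 0 ≤ T := hs.1.trans hs.2
  rcases hs.1.eq_or_lt with rfl | h0
  · simp [marginal, transMean_zero_zero hT, scaledVar_zero hT, heatFlow_zero]
  · have hm := transMean_pos (S := S) (zero_mem_Icc_of_mem hs) hs
    have hv : 0 < S.scaledVar s := by
      have := scaledVar_lt (S := S) (zero_mem_Icc_of_mem hs) hs h0
      rwa [scaledVar_zero hT] at this
    rw [marginal, if_neg h0.ne', heatFlow_of_pos hv, smear, ← integral_const_mul]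
    congr 1
    funext z
    have hV : S.transVar 0 s = S.transMean 0 s ^ 2 * S.scaledVar s := by
      rw [scaledVar]
      field_simp
    have hx : x - S.transMean 0 s • z =
        S.transMean 0 s • ((S.transMean 0 s)⁻¹ • x - z) := by
      rw [smul_sub, smul_inv_smul₀ hm.ne']
    rw [transDensity, gaussianDensity, heatKernel, hV, hx, norm_smul, Real.norm_of_nonneg hm.le,
      show 2 * π * (S.transMean 0 s ^ 2 * S.scaledVar s) =
        S.transMean 0 s ^ 2 * (2 * π * S.scaledVar s) by ring,
      Real.sqrt_mul (by positivity), Real.sqrt_sq hm.le, mul_pow, mul_inv, mul_pow,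
      show 2 * (S.transMean 0 s ^ 2 * S.scaledVar s) =
        S.transMean 0 s ^ 2 * (2 * S.scaledVar s) by ring, ← mul_neg,
      mul_div_mul_left _ _ (by positivity)]
    simp only [smul_eq_mul]
    ring

theorem logDensity_eq (hnn : ∀ x, 0 ≤ p₀ x) (hint : Integrable p₀) (hone : ∫ x, p₀ x = 1)
    {s : ℝ} (hs : s ∈ Icc 0 T) :
    S.logDensity p₀ s = fun x : EuclideanSpace ℝ (Fin D) =>
      Real.log ((S.transMean 0 s ^ D)⁻¹) + Real.log (heatFlow p₀ (S.scaledVar s)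
        ((S.transMean 0 s)⁻¹ • x)) := by
  funext x
  have hT : 0 ≤ T := hs.1.trans hs.2
  rw [logDensity, marginal_eq hs]
  rcases hs.1.eq_or_lt with rfl | h0
  -- At `s = 0` the prefactor is 1, so the logarithm splits even where `p₀` vanishes.
  · simp [transMean_zero_zero hT]
  · have hm := transMean_pos (S := S) (zero_mem_Icc_of_mem hs) hs
    have hv : 0 < S.scaledVar s := by
      have := scaledVar_lt (S := S) (zero_mem_Icc_of_mem hs) hs h0
      rwa [scaledVar_zero hT] at this
    exact Real.log_mul (by positivity) (heatFlow_pos hnn hint hone hv _).ne'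

theorem exists_denoising_eq (hnn : ∀ x, 0 ≤ p₀ x) (hint : Integrable p₀) (hone : ∫ x, p₀ x = 1)
    {s t : ℝ} (hs : s ∈ Icc 0 T) (ht : t ∈ Icc 0 T) (hst : s < t)
    (xt : EuclideanSpace ℝ (Fin D)) :
    ∃ A : ℝ, 0 < A ∧ ∀ x, S.denoising p₀ s t x xt =
      A * gaussianTilt ((S.transMean 0 t)⁻¹ • xt) (S.scaledVar t - S.scaledVar s)
        (heatFlow p₀ (S.scaledVar s)) ((S.transMean 0 s)⁻¹ • x) := by
  have hT : 0 ≤ T := hs.1.trans hs.2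
  have h0 := zero_mem_Icc_of_mem hs
  have hm := transMean_pos (S := S) h0 hs
  have hmt := transMean_pos (S := S) h0 ht
  have hd := sub_pos.2 (scaledVar_lt (S := S) hs ht hst)
  have hvt : 0 < S.scaledVar t := by
    have := scaledVar_lt (S := S) h0 ht (hs.1.trans_lt hst)
    rwa [scaledVar_zero hT] at this
  have hV : 0 < S.transVar s t := by
    rw [transVar_eq hs ht]
    positivity
  have hpt : 0 < S.marginal p₀ t xt := by
    rw [marginal_eq ht]
    have := heatFlow_pos hnn hint hone hvt ((S.transMean 0 t)⁻¹ • xt)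
    positivity
  refine ⟨(√(2 * π * S.transVar s t) ^ D)⁻¹ * (S.transMean 0 s ^ D)⁻¹ / S.marginal p₀ t xt,
    by positivity, fun x => ?_⟩
  have hx : xt - S.transMean s t • x =
      S.transMean 0 t • ((S.transMean 0 t)⁻¹ • xt - (S.transMean 0 s)⁻¹ • x) := by
    rw [smul_sub, smul_inv_smul₀ hmt.ne', smul_smul, transMean_eq_div hs, div_eq_mul_inv]
  have he : -‖xt - S.transMean s t • x‖ ^ 2 / (2 * S.transVar s t) =
      -‖(S.transMean 0 s)⁻¹ • x - (S.transMean 0 t)⁻¹ • xt‖ ^ 2 /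
        (2 * (S.scaledVar t - S.scaledVar s)) := by
    rw [hx, norm_smul, Real.norm_of_nonneg hmt.le, norm_sub_rev, transVar_eq hs ht]
    field_simp
  rw [denoising, marginal_eq hs x, transDensity, gaussianDensity, he, gaussianTilt]
  ring

theorem isMaxOn_denoising_iff (hnn : ∀ x, 0 ≤ p₀ x) (hint : Integrable p₀) (hone : ∫ x, p₀ x = 1)
    {s t : ℝ} (hs : s ∈ Icc 0 T) (ht : t ∈ Icc 0 T) (hst : s < t)
    (xt y : EuclideanSpace ℝ (Fin D)) :
    IsMaxOn (fun x => S.denoising p₀ s t x xt) univ y ↔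
      IsMaxOn (gaussianTilt ((S.transMean 0 t)⁻¹ • xt) (S.scaledVar t - S.scaledVar s)
        (heatFlow p₀ (S.scaledVar s))) univ ((S.transMean 0 s)⁻¹ • y) := by
  obtain ⟨A, hA, h⟩ := exists_denoising_eq (S := S) hnn hint hone hs ht hst xt
  have hm := transMean_pos (S := S) (zero_mem_Icc_of_mem hs) hs
  simp only [isMaxOn_iff, mem_univ, forall_true_left, h, mul_le_mul_iff_right₀ hA]
  refine ⟨fun H u => ?_, fun H x => H _⟩
  have := H (S.transMean 0 s • u)
  rwa [inv_smul_smul₀ hm.ne'] at this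

/-- The mode-tracking equation of the rescaled heat flow, expressed through the density `p_s`. -/
theorem mode_equation_of_heatFlow (hp : ContDiff ℝ 3 p₀) (hnn : ∀ x, 0 ≤ p₀ x)
    (hint : Integrable p₀) (hone : ∫ x, p₀ x = 1)
    {s t : ℝ} (hs : s ∈ Icc 0 T) (ht : t ∈ Icc 0 T) (y y' : EuclideanSpace ℝ (Fin D))
    (hpos : 0 < heatFlow p₀ (S.scaledVar s) ((S.transMean 0 s)⁻¹ • y))
    (heq : (fderiv ℝ (gradient fun u => Real.log (heatFlow p₀ (S.scaledVar s) u))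
          ((S.transMean 0 s)⁻¹ • y) -
        (S.scaledVar t - S.scaledVar s)⁻¹ • ContinuousLinearMap.id ℝ (EuclideanSpace ℝ (Fin D)))
        ((S.transMean 0 s)⁻¹ • (y' - S.f s • y) + (S.g s ^ 2 / S.transMean 0 s ^ 2) •
          gradient (fun u => Real.log (heatFlow p₀ (S.scaledVar s) u))
            ((S.transMean 0 s)⁻¹ • y)) =
      -((1 / 2 * (S.g s ^ 2 / S.transMean 0 s ^ 2)) •
        gradient (Laplacian.laplacian fun u => Real.log (heatFlow p₀ (S.scaledVar s) u))
          ((S.transMean 0 s)⁻¹ • y))) :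
    S.hessA p₀ t s y (y' - S.f s • y + S.g s ^ 2 • S.score p₀ s y) =
      -((1 / 2 * S.g s ^ 2) • S.gradLaplacian p₀ s y) := by
  have hT : 0 ≤ T := hs.1.trans hs.2
  have hm := transMean_pos (S := S) (zero_mem_Icc_of_mem hs) hs
  have hv : 0 ≤ S.scaledVar s := by
    rcases hs.1.eq_or_lt with rfl | h0
    · exact (scaledVar_zero hT).ge
    · have := scaledVar_lt (S := S) (zero_mem_Icc_of_mem hs) hs h0
      rw [scaledVar_zero hT] at this
      exact this.le
  have hC := (contDiff_heatFlow_of_nonneg hp hint hv).contDiffAt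
    (x := (S.transMean 0 s)⁻¹ • y)
  have hL := differentiable_laplacian_heatFlow hp hint hv ((S.transMean 0 s)⁻¹ • y)
  have hCl := hC.log hpos.ne'
  have hLl := (hasGradientAt_laplacian_log hC hL hpos).differentiableAt
  have hscore : S.score p₀ s = gradient (S.logDensity p₀ s) := rfl
  rw [hessA, gradLaplacian, hscore, logDensity_eq hnn hint hone hs, psi_eq_inv hs ht,
    fderiv_gradient_const_add_comp_smul _ _ hCl,
    gradient_const_add_comp_smul _ _ (hCl.differentiableAt (by simp)),
    gradient_laplacian_const_add_comp_smul _ _ hCl hLl]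
  generalize fderiv ℝ (gradient fun u => Real.log (heatFlow p₀ (S.scaledVar s) u))
    ((S.transMean 0 s)⁻¹ • y) = A at *
  generalize gradient (fun u => Real.log (heatFlow p₀ (S.scaledVar s) u))
    ((S.transMean 0 s)⁻¹ • y) = G at *
  generalize gradient (Laplacian.laplacian fun u => Real.log (heatFlow p₀ (S.scaledVar s) u))
    ((S.transMean 0 s)⁻¹ • y) = J at *
  generalize S.transMean 0 s = m at *
  generalize (S.scaledVar t - S.scaledVar s)⁻¹ = c at *
  -- Homogeneity in `m`: the velocity scales by `m`, the operator by `m⁻²` and the third-order term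
  -- by `m⁻³`; with `v' = g² / m²` both sides carry `m⁻¹` relative to the heat-flow equation.
  have h1 : y' - S.f s • y + S.g s ^ 2 • m⁻¹ • G =
      m • (m⁻¹ • (y' - S.f s • y) + (S.g s ^ 2 / m ^ 2) • G) := by
    rw [smul_add, smul_inv_smul₀ hm.ne', smul_smul, smul_smul]
    congr 2
    field_simp
  have h2 : m⁻¹ ^ 2 • A - (m⁻¹ ^ 2 * c) • ContinuousLinearMap.id ℝ (EuclideanSpace ℝ (Fin D)) =
      m⁻¹ ^ 2 • (A - c • ContinuousLinearMap.id ℝ (EuclideanSpace ℝ (Fin D))) := by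
    rw [smul_sub, smul_smul]
  rw [h1, h2, _root_.smul_apply, map_smul, heq]
  match_scalars
  field_simp

/-- A differentiable curve of modes of the denoising density starts at a mode, ends at `xt`, and
satisfies the differentiated first-order condition. -/
theorem mode_tracking (S : NoiseSchedule T) (hp₀_smooth : ContDiff ℝ 3 p₀)
    (hp₀_nonneg : ∀ x, 0 ≤ p₀ x) (hp₀_int : Integrable p₀) (hp₀_one : ∫ x, p₀ x = 1)
    (t : ℝ) (ht : t ∈ Ioc 0 T) (xt : EuclideanSpace ℝ (Fin D))
    (y : ℝ → EuclideanSpace ℝ (Fin D)) (hy_cont : ContinuousOn y (Icc 0 t))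
    (hy_smooth : ContDiffOn ℝ 1 y (Ico 0 t))
    (hy_mode : ∀ s ∈ Ioo 0 t, IsMaxOn (fun x => S.denoising p₀ s t x xt) univ (y s)) :
    y t = xt ∧
    (∀ s ∈ Ico 0 t,
      S.hessA p₀ t s (y s)
          (derivWithin y (Icc 0 t) s - S.f s • y s + S.g s ^ 2 • S.score p₀ s (y s)) =
        -((1 / 2 * S.g s ^ 2) • S.gradLaplacian p₀ s (y s))) ∧
    IsMaxOn (fun x => S.denoising p₀ 0 t x xt) univ (y 0) := by
  have hT : 0 ≤ T := ht.1.le.trans ht.2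
  have htm : t ∈ Icc 0 T := ⟨ht.1.le, ht.2⟩
  have h0m : (0 : ℝ) ∈ Icc 0 T := ⟨le_rfl, hT⟩
  have hsub : Icc 0 t ⊆ Icc 0 T := Icc_subset_Icc_right ht.2
  have hIoo : ∀ s ∈ Ioo 0 t, s ∈ Ioo 0 T := fun s hs => ⟨hs.1, hs.2.trans_le ht.2⟩
  have hIcc : ∀ s ∈ Ico 0 t, s ∈ Icc 0 T := fun s hs => hsub ⟨hs.1, hs.2.le⟩
  have hgt : 𝓝[>] (0 : ℝ) ≤ 𝓝[Icc 0 t] 0 :=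
    nhdsWithin_le_of_mem (mem_of_superset (Ioo_mem_nhdsGT ht.1) Ioo_subset_Icc_self)
  have hlt : 𝓝[<] t ≤ 𝓝[Icc 0 t] t :=
    nhdsWithin_le_of_mem (mem_of_superset (Ioo_mem_nhdsLT ht.1) Ioo_subset_Icc_self)
  have hmpos : ∀ s ∈ Icc 0 T, 0 < S.transMean 0 s := fun s hs => transMean_pos h0m hs
  have hmc : ContinuousOn (S.transMean 0) (Icc 0 t) := continuousOn_transMean.mono hsub
  have hvc : ContinuousOn S.scaledVar (Icc 0 t) := continuousOn_scaledVar.mono hsub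
  have hwc : ContinuousOn (fun s => (S.transMean 0 s)⁻¹ • y s) (Icc 0 t) :=
    (hmc.inv₀ fun s hs => (hmpos s (hsub hs)).ne').smul hy_cont
  have h0t : (0 : ℝ) ∈ Icc 0 t := ⟨le_rfl, ht.1.le⟩
  have htt : t ∈ Icc 0 t := ⟨ht.1.le, le_rfl⟩
  have hvpos : ∀ s ∈ Ioo 0 t, 0 < S.scaledVar s := fun s hs => by
    have := scaledVar_lt (S := S) h0m (hIcc s ⟨hs.1.le, hs.2⟩) hs.1
    rwa [scaledVar_zero hT] at this
  have hvt : ∀ s ∈ Ico 0 t, S.scaledVar s < S.scaledVar t := fun s hs =>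
    scaledVar_lt (hIcc s hs) htm hs.2
  have hτ : 0 < S.scaledVar t := scaledVar_zero (S := S) hT ▸ hvt 0 ⟨le_rfl, ht.1⟩
  have hv0 : S.scaledVar 0 = 0 := scaledVar_zero hT
  have hvlim : Tendsto S.scaledVar (𝓝[>] 0) (𝓝 0) := by
    have h : Tendsto S.scaledVar (𝓝[>] 0) (𝓝 (S.scaledVar 0)) := (hvc 0 h0t).mono_left hgt
    rwa [hv0] at h
  have hvlim' : Tendsto S.scaledVar (𝓝[>] 0) (𝓝[>] 0) := by
    refine tendsto_nhdsWithin_iff.2 ⟨hvlim, ?_⟩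
    filter_upwards [Ioo_mem_nhdsGT ht.1] with s hs using hvpos s hs
  have hmax : ∀ s ∈ Ioo 0 t, IsMaxOn (gaussianTilt ((S.transMean 0 t)⁻¹ • xt)
      (S.scaledVar t - S.scaledVar s) (heatFlow p₀ (S.scaledVar s))) univ
      ((S.transMean 0 s)⁻¹ • y s) := fun s hs =>
    (isMaxOn_denoising_iff hp₀_nonneg hp₀_int hp₀_one (hIcc s ⟨hs.1.le, hs.2⟩) htm hs.2 xt _).1
      (hy_mode s hs)
  -- The curve is only continuous at `t`, so smoothness is available on `Ico`; before `t` the two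
  -- sets have the same germ.
  have hderiv : ∀ s ∈ Ico 0 t, derivWithin y (Icc 0 t) s = derivWithin y (Ico 0 t) s := by
    intro s hs
    refine derivWithin_congr_set ?_
    filter_upwards [Iio_mem_nhds hs.2] with r hr
    exact propext ⟨fun h => ⟨h.1, hr⟩, fun h => ⟨h.1, h.2.le⟩⟩
  have hy'c : ContinuousOn (derivWithin y (Icc 0 t)) (Ico 0 t) :=
    (hy_smooth.continuousOn_derivWithin (uniqueDiffOn_Ico 0 t) le_rfl).congr hderiv
  have hy' : ∀ s ∈ Ioo 0 t, HasDerivAt y (derivWithin y (Icc 0 t) s) s := by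
    intro s hs
    rw [derivWithin_of_mem_nhds (Icc_mem_nhds hs.1 hs.2)]
    exact ((hy_smooth.differentiableOn one_ne_zero s ⟨hs.1.le, hs.2⟩).differentiableAt
      (Ico_mem_nhds hs.1 hs.2)).hasDerivAt
  have hgt' : 𝓝[>] (0 : ℝ) ≤ 𝓝[Ico 0 t] 0 :=
    nhdsWithin_le_of_mem (mem_of_superset (Ioo_mem_nhdsGT ht.1) Ioo_subset_Ico_self)
  have hfc : ContinuousWithinAt S.f (Icc 0 t) 0 := (S.f_cont.mono hsub) 0 h0t
  have hgc : ContinuousWithinAt S.g (Icc 0 t) 0 := (S.g_cont.mono hsub) 0 h0t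
  have hm0 := (hmpos 0 h0m).ne'
  -- The velocity of `w` is `m⁻¹ (y' - f y)` because `m' = f m`; this is where the drift enters.
  have hflow := heatFlow_mode_tracking (v := S.scaledVar)
    (v' := fun s => S.g s ^ 2 / S.transMean 0 s ^ 2) (w := fun s => (S.transMean 0 s)⁻¹ • y s)
    (w' := fun s => (S.transMean 0 s)⁻¹ • (derivWithin y (Icc 0 t) s - S.f s • y s))
    hp₀_smooth hp₀_nonneg hp₀_int hp₀_one ht.1 hv0 hvlim hvpos hvt
    (fun s hs => hasDerivAt_scaledVar (hIoo s hs))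
    (((hgc.pow 2).div ((hmc 0 h0t).pow 2) (pow_ne_zero 2 hm0)).mono_left hgt)
    ((hwc 0 h0t).mono_left hgt)
    (fun s hs => by
      have hm := (hmpos s (hIcc s ⟨hs.1.le, hs.2⟩)).ne'
      refine (((hasDerivAt_transMean (hIoo s hs)).inv hm).smul (hy' s hs)).congr_deriv ?_
      simp only [Pi.inv_apply]
      match_scalars
      · field_simp
      · field_simp)
    ((((hmc 0 h0t).inv₀ hm0).mono_left hgt).smul
      (((hy'c 0 ⟨le_rfl, ht.1⟩).mono_left hgt').sub
        ((hfc.mono_left hgt).smul ((hy_cont 0 h0t).mono_left hgt)))) hmax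
  refine ⟨?_, fun s hs => ?_, ?_⟩
  · have h := eq_of_isMaxOn_gaussianTilt hp₀_int hp₀_nonneg hp₀_one ht.1 hτ
      ((hvc t htt).mono_left hlt) (fun s hs => hvt s ⟨hs.1.le, hs.2⟩)
      ((hwc t htt).mono_left hlt) hmax
    exact smul_right_injective _ (inv_pos.2 (hmpos t htm)).ne' h
  · obtain ⟨hpos, heq⟩ := hflow s hs
    exact mode_equation_of_heatFlow hp₀_smooth hp₀_nonneg hp₀_int hp₀_one (hIcc s hs) htm _ _
      hpos heq
  · rw [isMaxOn_denoising_iff hp₀_nonneg hp₀_int hp₀_one h0m htm ht.1, hv0, sub_zero, heatFlow_zero]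
    exact isMaxOn_gaussianTilt_zero hp₀_smooth hp₀_int ht.1 hτ hvlim' ((hwc 0 h0t).mono_left hgt)
      hmax

end NoiseSchedule

end ModeTracking

/-! ### The mode-tracking ODE. -/

theorem theorem5 {D : ℕ} {T : ℝ} (S : ModeTracking.NoiseSchedule T)
    -- the density of the data distribution
    (p₀ : EuclideanSpace ℝ (Fin D) → ℝ) (hp₀_smooth : ContDiff ℝ 3 p₀)
    (hp₀_nonneg : ∀ x, 0 ≤ p₀ x) (hp₀_int : Integrable p₀) (hp₀_one : ∫ x, p₀ x = 1)
    (t : ℝ) (ht : t ∈ Ioc 0 T) (xt : EuclideanSpace ℝ (Fin D))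
    -- the mode-tracking curve
    (y : ℝ → EuclideanSpace ℝ (Fin D)) (hy_cont : ContinuousOn y (Icc 0 t))
    (hy_smooth : ContDiffOn ℝ 1 y (Ico 0 t))
    (hy_mode : ∀ s ∈ Ioo 0 t, IsMaxOn (fun x => S.denoising p₀ s t x xt) univ (y s)) :
    y t = xt ∧
    -- the equation without inverting `A`
    (∀ s ∈ Ico 0 t,
      S.hessA p₀ t s (y s)
          (derivWithin y (Icc 0 t) s - S.f s • y s + S.g s ^ 2 • S.score p₀ s (y s)) =
        -((1 / 2 * S.g s ^ 2) • S.gradLaplacian p₀ s (y s))) ∧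
    -- the mode-tracking ODE
    (∀ s ∈ Ico 0 t, (S.hessA p₀ t s (y s)).IsInvertible →
      HasDerivWithinAt y
        (S.f s • y s - S.g s ^ 2 • S.score p₀ s (y s) -
          (1 / 2 * S.g s ^ 2) •
            (S.hessA p₀ t s (y s)).inverse (S.gradLaplacian p₀ s (y s)))
        (Icc 0 t) s) ∧
    -- `y 0` is a mode of `p(x₀ | xt)`
    IsMaxOn (fun x => S.denoising p₀ 0 t x xt) univ (y 0) := by
  obtain ⟨h1, h2, h3⟩ := ModeTracking.NoiseSchedule.mode_tracking S hp₀_smooth hp₀_nonneg hp₀_int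
    hp₀_one t ht xt y hy_cont hy_smooth hy_mode
  refine ⟨h1, h2, fun s hs hA => ?_, h3⟩
  have hdiff : DifferentiableWithinAt ℝ y (Icc 0 t) s := by
    refine (hy_smooth.differentiableOn one_ne_zero s hs).mono_of_mem_nhdsWithin ?_
    filter_upwards [self_mem_nhdsWithin, mem_nhdsWithin_of_mem_nhds (Iio_mem_nhds hs.2)]
      with r hr hrt using ⟨hr.1, hrt⟩
  refine hdiff.hasDerivWithinAt.congr_deriv ?_
  -- Invertibility lets the inverse be applied to both sides; the velocity is then isolated by
  -- rearranging.
  have h := congrArg (S.hessA p₀ t s (y s)).inverse (h2 s hs)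
  rw [hA.inverse_apply_eq.2 rfl, map_neg, map_smul] at h
  rw [eq_sub_iff_add_eq, eq_sub_iff_add_eq, add_assoc, ← eq_sub_iff_add_eq, ← sub_eq_zero]
  rw [← sub_eq_zero] at h
  rw [← h]
  abel
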